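/- Let $(X,d)$ be a separable metric space with a Borel regular outer measure $\mu$ such that every ball has positive and finite measure. Let $\mathcal B=\bigcup_{x\in X}\mathcal B(x)$ be a Busemann--Feller basis on $X$: each $\mathcal B(x)$ consists of bounded open sets containing $x$ and contains sets of arbitrarily small diameter, and $x\in B\in\mathcal B$ implies $B\in\mathcal B(x)$. Write $u_B=\frac1{\mu(B)}\int_B u\,d\mu$ and \[ \mathcal M_{\mathcal B}u(x)=\sup_{x\in B\in\mathcal B}\frac1{\mu(B)}\int_B|u|\,d\mu . \] Let $L^0(X)$ be the set of measurable functions $u:X\to[-\infty,\infty]$ that are finite almost everywhere. For $s>0$ and $u\in L^0(X)$, a measurable $g:X\to[0,\infty]$ is an $s$-gradient of $u$ if there is a null set $E$ with $|u(x)-u(y)|\le d(x,y)^s(g(x)+g(y))$ for all $x,y\in X\setminus E$; a sequence $(g_k)_{k\in\mathbb Z}$ of nonnegative measurable functions is a fractional $s$-gradient of $u$ if there is a null set $E$ with $|u(x)-u(y)|\le d(x,y)^s(g_k(x)+g_k(y))$ for all $k\in\mathbb Z$ and all $x,y\in X\setminus E$ with $2^{-k-1}\le d(x,y)<2^{-k}$.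 The spaces $N^s_{p,q}(X)$, $M^s_{p,q}(X)$ and $M^{s,p}(X)$ consist of those $u\in L^0(X)$ for which, respectively, \[ \|u\|_{N^s_{p,q}}=\|u\|_{L^p}+\inf_{(g_k)}\Big\|\big(\|g_k\|_{L^p}\big)_{k}\Big\|_{l^q},\qquad \|u\|_{M^s_{p,q}}=\|u\|_{L^p}+\inf_{(g_k)}\Big\|\|(g_k)_k\|_{l^q}\Big\|_{L^p},\qquad \|u\|_{M^{s,p}}=\|u\|_{L^p}+\inf_g\|g\|_{L^p} \] is finite, the infima being over all fractional $s$-gradients $(g_k)$, respectively all $s$-gradients $g$, of $u$. Let $\mathcal F\in\{N^s_{p,q}(X),M^s_{p,q}(X)\}$ with $0<s<1$ and $1<p,q<\infty$, or $\mathcal F=M^s_{p,\infty}(X)=M^{s,p}(X)$ with $0<s\le1$ and $1<p<\infty$. For $E\subset X$ let \[ C_{\mathcal F}(E)=\inf\{\|u\|_{\mathcal F}^p:\ u\in\mathcal F,\ u\ge1\text{ on a neighbourhood of }E\} \] (with $\inf\emptyset=\infty$). A function $u:X\to[-\infty,\infty]$ is quasicontinuous if for every $\varepsilon>0$ there is a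 set $E\subset X$ such that $C_{\mathcal F}(E)<\varepsilon$ and the restriction of $u$ to $X\setminus E$ is continuous. Consider the following claims. (1) For each $u\in\mathcal F$, $C_{\mathcal F}(\{x\in X:\mathcal M_{\mathcal B}u(x)>\lambda\})\to0$ as $\lambda\to\infty$. (2) For each $\lambda>0$ and each sequence $(u_k)$ in $\mathcal F$ such that $\|u_k\|_{\mathcal F}\to0$ as $k\to\infty$, we have $C_{\mathcal F}(\{x\in X:\mathcal M_{\mathcal B}u_k(x)>\lambda\})\to0$ as $k\to\infty$. (3) For every quasicontinuous $u\in\mathcal F$ there exists a set $E$ with $C_{\mathcal F}(E)=0$ such that \[ \lim_{\mathcal B(x)\ni B,\ \operatorname{diam}(B)\to0}u_B=u(x) \] for every $x\in X\setminus E$. Then $(1)\Rightarrow(2)\Rightarrow(3)$. -/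

import Mathlib

open MeasureTheory Filter Topology
open scoped ENNReal

noncomputable section

/-- Every ball has positive and finite measure. -/
def BallsPosFinite {X : Type*} [MetricSpace X] [MeasurableSpace X] (μ : Measure X) : Prop :=
  ∀ (x : X) (r : ℝ), 0 < r → 0 < μ (Metric.ball x r) ∧ μ (Metric.ball x r) < ∞

/-! ### Differentiation bases -/

/-- A differentiation basis, given by the families `𝓑 x` of bounded measurable sets containing `x`;
each family contains sets of arbitrarily small diameter.  Measurability refers to the completion
of the Borel measure `μ`. -/
structure IsDifferentiationBasis {X : Type*} [MetricSpace X] [MeasurableSpace X] (μ : Measure X)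
    (𝓑 : X → Set (Set X)) : Prop where
  isBounded : ∀ x, ∀ B ∈ 𝓑 x, Bornology.IsBounded B
  measurable : ∀ x, ∀ B ∈ 𝓑 x, NullMeasurableSet B μ
  mem : ∀ x, ∀ B ∈ 𝓑 x, x ∈ B
  exists_small : ∀ x, ∀ ε : ℝ, 0 < ε → ∃ B ∈ 𝓑 x, Metric.diam B < ε

/-- A Busemann--Feller basis: the sets are open, and a set of the basis belongs to the family
of each of its points. -/
structure IsBusemannFellerBasis {X : Type*} [MetricSpace X] [MeasurableSpace X] (μ : Measure X)
    (𝓑 : X → Set (Set X)) : Prop extends IsDifferentiationBasis μ 𝓑 where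
  isOpen : ∀ x, ∀ B ∈ 𝓑 x, IsOpen B
  mem_of_mem : ∀ x, ∀ B ∈ ⋃ y, 𝓑 y, x ∈ B → B ∈ 𝓑 x

/-- The filter describing `𝓑 ∋ B → x`: sets `B ∈ 𝓑 x` with diameter tending to zero. -/
def basisFilter {X : Type*} [MetricSpace X] (𝓑 : X → Set (Set X)) (x : X) : Filter (Set X) :=
  ⨅ ε ∈ Set.Ioi (0 : ℝ), 𝓟 {B | B ∈ 𝓑 x ∧ Metric.diam B < ε}

/-- The maximal function: the supremum of the averages of `|u|` over all `B` in the basis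
that contain `x`. -/
def maximalFunction {X : Type*} [MeasurableSpace X] (μ : Measure X)
    (𝓑 : X → Set (Set X)) (u : X → EReal) (x : X) : ℝ≥0∞ :=
  ⨆ B ∈ {B | B ∈ ⋃ y, 𝓑 y ∧ x ∈ B}, ⨍⁻ y in B, (u y).abs ∂μ

/-- The integral average of `u` over `B`. -/
def integralAverage {X : Type*} [MeasurableSpace X] (μ : Measure X) (u : X → EReal)
    (B : Set X) : ℝ :=
  ⨍ y in B, (u y).toReal ∂μ

/-! ### Function spaces -/

/-- The class `L⁰` of measurable, almost everywhere finite functions with values in `[-∞, ∞]`. -/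
def MemLZero {X : Type*} [MeasurableSpace X] (μ : Measure X) (u : X → EReal) : Prop :=
  AEMeasurable u μ ∧ ∀ᵐ x ∂μ, u x ≠ ⊤ ∧ u x ≠ ⊥

/-- `g` is an `s`-gradient of `u`.  For `u` in `L⁰` the points where `u` is infinite may be put
into the exceptional null set `E`, so that `toReal` does no harm. -/
def IsSGradient {X : Type*} [MetricSpace X] [MeasurableSpace X] (μ : Measure X) (s : ℝ)
    (u : X → EReal) (g : X → ℝ≥0∞) : Prop :=
  AEMeasurable g μ ∧ ∃ E : Set X, μ E = 0 ∧ ∀ x ∉ E, ∀ y ∉ E,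
    edist (u x).toReal (u y).toReal ≤ ENNReal.ofReal (dist x y ^ s) * (g x + g y)

/-- `(g k)`, `k ∈ ℤ`, is a fractional `s`-gradient of `u`. -/
def IsFractionalGradient {X : Type*} [MetricSpace X] [MeasurableSpace X] (μ : Measure X) (s : ℝ)
    (u : X → EReal) (g : ℤ → X → ℝ≥0∞) : Prop :=
  (∀ k, AEMeasurable (g k) μ) ∧ ∃ E : Set X, μ E = 0 ∧ ∀ k : ℤ, ∀ x ∉ E, ∀ y ∉ E,
    (2 : ℝ) ^ (-k - 1) ≤ dist x y → dist x y < (2 : ℝ) ^ (-k) →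
    edist (u x).toReal (u y).toReal ≤ ENNReal.ofReal (dist x y ^ s) * (g k x + g k y)

/-- The (quasi-)norm of a sequence in `l^q(ℤ)`, `0 < q ≤ ∞`. -/
def lqNorm (q : ℝ≥0∞) (a : ℤ → ℝ≥0∞) : ℝ≥0∞ :=
  eLpNorm a q Measure.count

/-- The `L^p` (quasi-)norm of a function with values in `[-∞, ∞]`. -/
def lpNormEReal {X : Type*} [MeasurableSpace X] (μ : Measure X) (p : ℝ≥0∞) (u : X → EReal) :
    ℝ≥0∞ :=
  eLpNorm (fun x => (u x).abs) p μ

/-- The norm of the Hajłasz space `M^{s,p}`. -/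
def hajlaszNorm {X : Type*} [MetricSpace X] [MeasurableSpace X] (μ : Measure X) (s : ℝ)
    (p : ℝ≥0∞) (u : X → EReal) : ℝ≥0∞ :=
  lpNormEReal μ p u + ⨅ g ∈ {g | IsSGradient μ s u g}, eLpNorm g p μ

/-- The norm of the Hajłasz--Triebel--Lizorkin space `M^s_{p,q}`. -/
def triebelLizorkinNorm {X : Type*} [MetricSpace X] [MeasurableSpace X] (μ : Measure X) (s : ℝ)
    (p q : ℝ≥0∞) (u : X → EReal) : ℝ≥0∞ :=
  lpNormEReal μ p u +
    ⨅ g ∈ {g | IsFractionalGradient μ s u g}, eLpNorm (fun x => lqNorm q fun k => g k x) p μ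

/-- The norm of the Hajłasz--Besov space `N^s_{p,q}`. -/
def besovNorm {X : Type*} [MetricSpace X] [MeasurableSpace X] (μ : Measure X) (s : ℝ)
    (p q : ℝ≥0∞) (u : X → EReal) : ℝ≥0∞ :=
  lpNormEReal μ p u +
    ⨅ g ∈ {g | IsFractionalGradient μ s u g}, lqNorm q fun k => eLpNorm (g k) p μ

/-- The function space with norm `N`: the functions in `L⁰` of finite norm. -/
def spaceOf {X : Type*} [MeasurableSpace X] (μ : Measure X) (N : (X → EReal) → ℝ≥0∞) :
    Set (X → EReal) :=
  {u | MemLZero μ u ∧ N u < ∞}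

/-! ### Capacity and quasicontinuity -/

/-- The capacity of `E` for the space with norm `N` and integrability exponent `p`: the infimum
of `N u ^ p` over the functions `u` of the space with `u ≥ 1` on a neighbourhood of `E`. -/
def capacity {X : Type*} [MetricSpace X] [MeasurableSpace X] (μ : Measure X)
    (N : (X → EReal) → ℝ≥0∞) (p : ℝ≥0∞) (E : Set X) : ℝ≥0∞ :=
  ⨅ u ∈ {u | u ∈ spaceOf μ N ∧ ∃ U : Set X, IsOpen U ∧ E ⊆ U ∧ ∀ x ∈ U, 1 ≤ u x},
    N u ^ p.toReal

/-- `u` is quasicontinuous: off sets of arbitrarily small capacity, its restriction is continuous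
(as a function with values in `[-∞, ∞]`). -/
def IsQuasicontinuous {X : Type*} [MetricSpace X] [MeasurableSpace X] (μ : Measure X)
    (N : (X → EReal) → ℝ≥0∞) (p : ℝ≥0∞) (u : X → EReal) : Prop :=
  ∀ ε : ℝ, 0 < ε → ∃ E : Set X, capacity μ N p E < ENNReal.ofReal ε ∧ ContinuousOn u Eᶜ

end

open MeasureTheory Filter Topology
open scoped ENNReal

/-! All the spaces have a norm `‖u‖_p + inf Φ(g)` over fractional gradients, where `Φ` is a mixed
norm. Four properties of `Φ` suffice (`IsGradientNorm`): Minkowski's inequality for series,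
monotonicity, a bound on sequences with one nonzero term, and dominated convergence for cut-offs. If
the norms of `u_i`, weighted by `c_i`, are summable, then `F = ∑ c_i |u_i|` lies in the space
(`exists_majorant_of_tsum`). Hence the `p`-th root of the capacity is countably subadditive, and a
Borel–Cantelli argument holds.

(1) ⇒ (2): if (2) fails, some `u_i` of norm below `4⁻ⁱ` have `{M u_i > t}` of capacity above a fixed
`δ`. With `F = ∑ 2ⁱ |u_i|` these sets lie in `{M F > 2ⁱ t}`, contradicting (1) for `F`.

(2) ⇒ (3): the truncations `f = (|u| - 3n)₊` tend to zero in norm (`tendsto_norm_upperTruncation`).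
Take `L = 3n + 1` and an open `U` off which `u` is continuous, with `|v| ≥ 1` on `U` and `v` of
small norm. Clamp `u` to `[-L, L]` and extend the result from `Uᶜ` to a continuous `h` by Tietze. If
`x ∉ U` and `|u(x)| ≤ L`, then `|u - u(x)| ≤ f + 2L|v| + e` almost everywhere on small basis sets
containing `x`, so the averages differ from `u(x)` by at most `M f(x) + 2L M v(x) + e`. By (2) both
maximal terms are small off sets of small capacity, and Borel–Cantelli over the scales `2⁻ᵐ`
concludes. -/

noncomputable section

/-! ### Minkowski and dominated convergence in `L^r` -/

section LpNorm

variable {α : Type*} {m : MeasurableSpace α} {ν : Measure α} {r : ℝ≥0∞}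

/-- Minkowski's inequality for countable sums of nonnegative functions. -/
theorem eLpNorm_tsum_le_tsum (hr : 1 ≤ r) {f : ℕ → α → ℝ≥0∞} (hf : ∀ i, AEMeasurable (f i) ν) :
    eLpNorm (fun x => ∑' i, f i x) r ν ≤ ∑' i, eLpNorm (f i) r ν := by
  rcases eq_or_ne r ∞ with rfl | hr'
  · simp only [eLpNorm_exponent_top]
    have h : ∀ᵐ x ∂ν, ∀ i, f i x ≤ eLpNormEssSup (f i) ν := by
      rw [ae_all_iff]
      intro i
      exact enorm_ae_le_eLpNormEssSup (f i) ν
    refine essSup_le_of_ae_le _ ?_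
    filter_upwards [h] with x hx
    exact ENNReal.tsum_le_tsum hx
  have hr0 : r ≠ 0 := (zero_lt_one.trans_le hr).ne'
  have hrpos : 0 < r.toReal := ENNReal.toReal_pos hr0 hr'
  have hpart : ∀ n, eLpNorm (fun x => ∑ i ∈ Finset.range n, f i x) r ν ≤
      ∑' i, eLpNorm (f i) r ν := by
    intro n
    have := eLpNorm_sum_le (s := Finset.range n) (f := f) (p := r) (μ := ν)
      (fun i _ => (hf i).aestronglyMeasurable) hr
    refine le_trans (le_of_eq ?_) (this.trans (ENNReal.sum_le_tsum _))
    congr 1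
    ext x
    simp
  have hlim : Tendsto (fun n => eLpNorm (fun x => ∑ i ∈ Finset.range n, f i x) r ν) atTop
      (𝓝 (eLpNorm (fun x => ∑' i, f i x) r ν)) := by
    simp only [eLpNorm_eq_lintegral_rpow_enorm_toReal hr0 hr', enorm_eq_self]
    refine Tendsto.ennrpow_const _ ?_
    refine lintegral_tendsto_of_tendsto_of_monotone (fun n => ?_) ?_ ?_
    · exact (Finset.aemeasurable_fun_sum _ fun i _ => hf i).pow_const _
    · refine Eventually.of_forall fun x a b hab => ?_
      exact ENNReal.rpow_le_rpow (Finset.sum_le_sum_of_subset (Finset.range_mono hab)) hrpos.le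
    · exact Eventually.of_forall fun x => (ENNReal.tendsto_nat_tsum _).ennrpow_const _
  exact le_of_tendsto' hlim hpart

theorem eLpNorm_nnreal_mul_le (c : NNReal) (f : α → ℝ≥0∞) :
    eLpNorm (fun x => (c : ℝ≥0∞) * f x) r ν ≤ c * eLpNorm f r ν :=
  eLpNorm_le_nnreal_smul_eLpNorm_of_ae_le_mul' (Eventually.of_forall fun x => by simp) r

theorem eLpNorm_mono_ennreal {f g : α → ℝ≥0∞} (h : ∀ x, f x ≤ g x) :
    eLpNorm f r ν ≤ eLpNorm g r ν :=
  eLpNorm_mono_enorm fun x => by simpa using h x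

/-- Dominated convergence in `L^r`, `r < ∞`, for nonnegative functions tending to zero. -/
theorem tendsto_eLpNorm_zero_of_dominated (hr0 : r ≠ 0) (hr : r ≠ ∞) {F : ℕ → α → ℝ≥0∞}
    {b : α → ℝ≥0∞} (hF : ∀ n, AEMeasurable (F n) ν) (hb : ∀ n x, F n x ≤ b x)
    (hfin : eLpNorm b r ν ≠ ∞) (hlim : ∀ᵐ x ∂ν, Tendsto (fun n => F n x) atTop (𝓝 0)) :
    Tendsto (fun n => eLpNorm (F n) r ν) atTop (𝓝 0) := by
  have hrpos : 0 < r.toReal := ENNReal.toReal_pos hr0 hr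
  have key : Tendsto (fun n => ∫⁻ x, F n x ^ r.toReal ∂ν) atTop (𝓝 (∫⁻ _, 0 ∂ν)) := by
    refine tendsto_lintegral_of_dominated_convergence' (fun x => b x ^ r.toReal)
      (fun n => (hF n).pow_const _)
      (fun n => Eventually.of_forall fun x => ENNReal.rpow_le_rpow (hb n x) hrpos.le) ?_ ?_
    · have := lintegral_rpow_enorm_lt_top_of_eLpNorm_lt_top hr0 hr hfin.lt_top
      simpa using this.ne
    · filter_upwards [hlim] with x hx
      simpa [hrpos] using hx.ennrpow_const r.toReal
  have := key.ennrpow_const (1 / r.toReal)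
  simp only [eLpNorm_eq_lintegral_rpow_enorm_toReal hr0 hr, enorm_eq_self]
  simpa [hrpos] using this

end LpNorm

/-! ### Sequence norms on `ℤ` -/

section SequenceNorm

variable {q : ℝ≥0∞}

theorem lqNorm_top (a : ℤ → ℝ≥0∞) : lqNorm ∞ a = ⨆ k, a k := by
  simp [lqNorm]

theorem lqNorm_eq_tsum (hq0 : q ≠ 0) (hq : q ≠ ∞) (a : ℤ → ℝ≥0∞) :
    lqNorm q a = (∑' k, a k ^ q.toReal) ^ (1 / q.toReal) := by
  simp [lqNorm, eLpNorm_eq_lintegral_rpow_enorm_toReal hq0 hq, lintegral_count]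

theorem le_lqNorm (hq0 : q ≠ 0) (a : ℤ → ℝ≥0∞) (k : ℤ) : a k ≤ lqNorm q a := by
  simpa [lqNorm] using enorm_le_eLpNorm_count a k hq0

theorem lqNorm_mono {a b : ℤ → ℝ≥0∞} (h : ∀ k, a k ≤ b k) : lqNorm q a ≤ lqNorm q b :=
  eLpNorm_mono_ennreal h

theorem lqNorm_single_le (hq0 : q ≠ 0) (k : ℤ) (c : ℝ≥0∞) :
    lqNorm q (fun j => if j = k then c else 0) ≤ c := by
  rcases eq_or_ne q ∞ with rfl | hq
  · rw [lqNorm_top]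
    refine iSup_le fun j => ?_
    split_ifs <;> simp
  · have hqpos : 0 < q.toReal := ENNReal.toReal_pos hq0 hq
    rw [lqNorm_eq_tsum hq0 hq, tsum_eq_single k]
    · simp [← ENNReal.rpow_mul, hqpos.ne']
    · intro j hj
      simp [hj, hqpos]

theorem lqNorm_tsum_le (hq : 1 ≤ q) (a : ℕ → ℤ → ℝ≥0∞) :
    lqNorm q (fun k => ∑' i, a i k) ≤ ∑' i, lqNorm q (a i) :=
  eLpNorm_tsum_le_tsum hq fun i => (measurable_of_countable (a i)).aemeasurable

theorem lqNorm_nnreal_mul_le (c : NNReal) (a : ℤ → ℝ≥0∞) :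
    lqNorm q (fun k => (c : ℝ≥0∞) * a k) ≤ c * lqNorm q a :=
  eLpNorm_nnreal_mul_le c a

theorem aemeasurable_lqNorm {α : Type*} {m : MeasurableSpace α} {ν : Measure α} (hq0 : q ≠ 0)
    {g : ℤ → α → ℝ≥0∞} (hg : ∀ k, AEMeasurable (g k) ν) :
    AEMeasurable (fun x => lqNorm q fun k => g k x) ν := by
  rcases eq_or_ne q ∞ with rfl | hq
  · simp only [lqNorm_top]
    exact AEMeasurable.iSup hg
  · simp only [lqNorm_eq_tsum hq0 hq]
    exact (AEMeasurable.tsum fun k => (hg k).pow_const _).pow_const _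

end SequenceNorm

/-! ### Norms of sequences of functions -/

open Classical in
/-- The part of `g` where `g` or `w` exceeds `n`. -/
def upperPart {X : Type*} (g w : X → ℝ≥0∞) (n : ℕ) (x : X) : ℝ≥0∞ :=
  if (n : ℝ≥0∞) < g x ∨ (n : ℝ≥0∞) < w x then g x else 0

theorem upperPart_le {X : Type*} (g w : X → ℝ≥0∞) (n : ℕ) (x : X) : upperPart g w n x ≤ g x := by
  unfold upperPart; split_ifs <;> simp

theorem tendsto_upperPart {X : Type*} {g w : X → ℝ≥0∞} {x : X} (hg : g x ≠ ∞) (hw : w x ≠ ∞) :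
    Tendsto (fun n => upperPart g w n x) atTop (𝓝 0) := by
  obtain ⟨n, hn⟩ := ENNReal.exists_nat_gt hg
  obtain ⟨k, hk⟩ := ENNReal.exists_nat_gt hw
  refine tendsto_const_nhds.congr' ?_
  filter_upwards [eventually_ge_atTop n, eventually_ge_atTop k] with j hj hj'
  have h₁ : g x < j := hn.trans_le (by exact_mod_cast hj)
  have h₂ : w x < j := hk.trans_le (by exact_mod_cast hj')
  simp [upperPart, h₁.le, h₂.le]

theorem AEMeasurable.upperPart {X : Type*} [MeasurableSpace X] {μ : Measure X} {g w : X → ℝ≥0∞}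
    (hg : AEMeasurable g μ) (hw : AEMeasurable w μ) (n : ℕ) :
    AEMeasurable (upperPart g w n) μ := by
  have hm : Measurable fun z : ℝ≥0∞ × ℝ≥0∞ => (_root_.upperPart Prod.fst Prod.snd n z : ℝ≥0∞) := by
    unfold _root_.upperPart
    refine Measurable.ite ?_ measurable_fst measurable_const
    exact (measurableSet_lt measurable_const measurable_fst).union
      (measurableSet_lt measurable_const measurable_snd)
  exact hm.comp_aemeasurable (hg.prodMk hw)

/-- The properties of the functionals `(g_k) ↦ ‖(‖g_k‖_p)‖_q` and `(g_k) ↦ ‖‖(g_k)‖_q‖_p` that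
are used below. -/
structure IsGradientNorm {X : Type*} [MeasurableSpace X] (μ : Measure X) (p : ℝ≥0∞)
    (Φ : (ℤ → X → ℝ≥0∞) → ℝ≥0∞) : Prop where
  tsum_le : ∀ (c : ℕ → NNReal) (g : ℕ → ℤ → X → ℝ≥0∞), (∀ i k, AEMeasurable (g i k) μ) →
    Φ (fun k x => ∑' i, (c i : ℝ≥0∞) * g i k x) ≤ ∑' i, (c i : ℝ≥0∞) * Φ (g i)
  mono : ∀ g g' : ℤ → X → ℝ≥0∞, (∀ k x, g k x ≤ g' k x) → Φ g ≤ Φ g'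
  single_le : ∀ (k : ℤ) (f : X → ℝ≥0∞), Φ (fun j x => if j = k then f x else 0) ≤ eLpNorm f p μ
  tendsto_upperPart : ∀ (g : ℤ → X → ℝ≥0∞) (w : X → ℝ≥0∞), (∀ k, AEMeasurable (g k) μ) →
    AEMeasurable w μ → (∀ᵐ x ∂μ, w x ≠ ∞) → Φ g ≠ ∞ →
    Tendsto (fun n => Φ fun k => upperPart (g k) w n) atTop (𝓝 0)

theorem ae_ne_top_of_eLpNorm_ne_top {X : Type*} [MeasurableSpace X] {μ : Measure X} {p : ℝ≥0∞}
    (hp0 : p ≠ 0) {f : X → ℝ≥0∞} (hf : AEMeasurable f μ) (h : eLpNorm f p μ ≠ ∞) :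
    ∀ᵐ x ∂μ, f x ≠ ∞ := by
  rcases eq_or_ne p ∞ with rfl | hp
  · filter_upwards [enorm_ae_le_eLpNormEssSup f μ] with x hx
    rw [eLpNorm_exponent_top] at h
    exact (lt_of_le_of_lt (by simpa using hx) h.lt_top).ne
  · have hpos : 0 < p.toReal := ENNReal.toReal_pos hp0 hp
    have h1 := lintegral_rpow_enorm_lt_top_of_eLpNorm_lt_top hp0 hp h.lt_top
    filter_upwards [ae_lt_top' (hf.enorm.pow_const _) h1.ne] with x hx hx'
    simp [hx', hpos] at hx

/-- The cut-off property allows `q = ∞`: cutting each `g k` at height `n` is dominated pointwise by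
cutting the whole `l^q` norm at height `n`, so dominated convergence is needed only in `L^p`. -/
theorem isGradientNorm_triebelLizorkin {X : Type*} [MeasurableSpace X] (μ : Measure X)
    {p q : ℝ≥0∞} (hp₁ : 1 ≤ p) (hp : p ≠ ∞) (hq₁ : 1 ≤ q) :
    IsGradientNorm μ p fun g => eLpNorm (fun x => lqNorm q fun k => g k x) p μ := by
  have hp0 : p ≠ 0 := (zero_lt_one.trans_le hp₁).ne'
  have hq0 : q ≠ 0 := (zero_lt_one.trans_le hq₁).ne'
  refine ⟨fun c g hg => ?_, fun g g' h => ?_, fun k f => ?_, fun g w hg hw hw' hfin => ?_⟩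
  · calc eLpNorm (fun x => lqNorm q fun k => ∑' i, (c i : ℝ≥0∞) * g i k x) p μ
        ≤ eLpNorm (fun x => ∑' i, (c i : ℝ≥0∞) * lqNorm q fun k => g i k x) p μ :=
          eLpNorm_mono_ennreal fun x => (lqNorm_tsum_le hq₁ _).trans <|
            ENNReal.tsum_le_tsum fun i => lqNorm_nnreal_mul_le _ _
      _ ≤ ∑' i, eLpNorm (fun x => (c i : ℝ≥0∞) * lqNorm q fun k => g i k x) p μ :=
          eLpNorm_tsum_le_tsum hp₁ fun i => (aemeasurable_lqNorm hq0 (hg i)).const_mul _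
      _ ≤ _ := ENNReal.tsum_le_tsum fun i => eLpNorm_nnreal_mul_le _ _
  · exact eLpNorm_mono_ennreal fun x => lqNorm_mono fun k => h k x
  · exact eLpNorm_mono_ennreal fun x => lqNorm_single_le hq0 _ _
  · have hG := aemeasurable_lqNorm hq0 hg
    have hdom : ∀ n x, (lqNorm q fun k => upperPart (g k) w n x) ≤
        upperPart (fun x => lqNorm q fun k => g k x) w n x := by
      intro n x
      by_cases h : (n : ℝ≥0∞) < (lqNorm q fun k => g k x) ∨ (n : ℝ≥0∞) < w x
      · rw [upperPart, if_pos h]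
        exact lqNorm_mono fun k => upperPart_le _ _ _ _
      · have : ∀ k, upperPart (g k) w n x = 0 := fun k =>
          if_neg fun h' => h (h'.imp_left fun h'' => h''.trans_le (le_lqNorm hq0 (fun k => g k x) k))
        simp [this, lqNorm]
    refine tendsto_of_tendsto_of_tendsto_of_le_of_le tendsto_const_nhds
      (tendsto_eLpNorm_zero_of_dominated (ν := μ) hp0 hp (fun n => hG.upperPart hw n)
        (fun n x => upperPart_le _ _ _ _) hfin ?_)
      (fun n => zero_le) (fun n => eLpNorm_mono_ennreal (hdom n))
    filter_upwards [hw', ae_ne_top_of_eLpNorm_ne_top hp0 hG hfin] with x h1 h2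
    exact tendsto_upperPart h2 h1

/-- Dominated convergence is applied twice, in `L^p` for each `k` and then in `l^q`; the latter
needs `q < ∞`. -/
theorem isGradientNorm_besov {X : Type*} [MeasurableSpace X] (μ : Measure X)
    {p q : ℝ≥0∞} (hp₁ : 1 ≤ p) (hp : p ≠ ∞) (hq₁ : 1 ≤ q) (hq : q ≠ ∞) :
    IsGradientNorm μ p fun g => lqNorm q fun k => eLpNorm (g k) p μ := by
  have hp0 : p ≠ 0 := (zero_lt_one.trans_le hp₁).ne'
  have hq0 : q ≠ 0 := (zero_lt_one.trans_le hq₁).ne'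
  refine ⟨fun c g hg => ?_, fun g g' h => ?_, fun k f => ?_, fun g w hg hw hw' hfin => ?_⟩
  · calc (lqNorm q fun k => eLpNorm (fun x => ∑' i, (c i : ℝ≥0∞) * g i k x) p μ)
        ≤ lqNorm q fun k => ∑' i, (c i : ℝ≥0∞) * eLpNorm (g i k) p μ :=
          lqNorm_mono fun k => (eLpNorm_tsum_le_tsum hp₁ fun i => (hg i k).const_mul _).trans <|
            ENNReal.tsum_le_tsum fun i => eLpNorm_nnreal_mul_le _ _
      _ ≤ ∑' i, lqNorm q fun k => (c i : ℝ≥0∞) * eLpNorm (g i k) p μ := lqNorm_tsum_le hq₁ _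
      _ ≤ _ := ENNReal.tsum_le_tsum fun i => lqNorm_nnreal_mul_le _ _
  · exact lqNorm_mono fun k => eLpNorm_mono_ennreal fun x => h k x
  · refine (lqNorm_mono fun j => ?_).trans (lqNorm_single_le hq0 k _)
    split_ifs with h
    · simp [h]
    · simp [h]
  · refine tendsto_eLpNorm_zero_of_dominated hq0 hq
      (fun n => (measurable_of_countable _).aemeasurable)
      (fun n k => eLpNorm_mono_ennreal fun x => upperPart_le _ _ _ _) hfin
      (Eventually.of_forall fun k => ?_)
    have hk : eLpNorm (g k) p μ ≠ ∞ :=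
      ((le_lqNorm hq0 (fun k => eLpNorm (g k) p μ) k).trans_lt (lt_top_iff_ne_top.2 hfin)).ne
    refine tendsto_eLpNorm_zero_of_dominated hp0 hp (fun n => (hg k).upperPart hw n)
      (fun n x => upperPart_le _ _ _ _) hk ?_
    filter_upwards [hw', ae_ne_top_of_eLpNorm_ne_top hp0 (hg k) hk] with x h1 h2
    exact tendsto_upperPart h2 h1

/-! ### Absolute values in `EReal` -/

theorem EReal.abs_coe_ennreal (a : ℝ≥0∞) : (a : EReal).abs = a := by
  rcases eq_or_ne a ∞ with rfl | ha
  · simp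
  · lift a to NNReal using ha
    rw [show (((a : ℝ≥0∞)) : EReal) = ((a : ℝ) : EReal) from rfl, EReal.abs_def]
    simp [abs_of_nonneg a.coe_nonneg]

theorem EReal.measurable_abs : Measurable EReal.abs := by
  refine EReal.measurable_of_measurable_real ?_
  simp only [EReal.abs_def]
  exact (measurable_norm (α := ℝ)).ennreal_ofReal

theorem EReal.abs_ne_top_iff {z : EReal} : z.abs ≠ ∞ ↔ z ≠ ⊤ ∧ z ≠ ⊥ := by
  induction z with
  | bot => simp
  | top => simp
  | coe r => simp [EReal.abs_def]

theorem EReal.one_le_abs {z : EReal} (h : 1 ≤ z) : 1 ≤ z.abs := by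
  induction z with
  | bot => simp
  | top => simp
  | coe r =>
    have : (1 : ℝ) ≤ r := by exact_mod_cast h
    rw [EReal.abs_def, ← ENNReal.ofReal_one]
    exact ENNReal.ofReal_le_ofReal (this.trans (le_abs_self r))

theorem EReal.abs_le_abs_add_edist {z w : EReal} (hz : z.abs ≠ ∞) (hw : w.abs ≠ ∞) :
    z.abs ≤ w.abs + edist z.toReal w.toReal := by
  rw [EReal.abs_ne_top_iff] at hz hw
  lift z to ℝ using hz
  lift w to ℝ using hw
  simp only [EReal.abs_def, EReal.toReal_coe, edist_dist, Real.dist_eq]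
  rw [← ENNReal.ofReal_add (abs_nonneg _) (abs_nonneg _)]
  refine ENNReal.ofReal_le_ofReal ?_
  have := abs_add_le w (z - w)
  simpa using this

theorem EReal.edist_toReal_coe_le {a b d : ℝ≥0∞} (ha : a ≠ ∞) (hb : b ≠ ∞) (h₁ : a ≤ b + d)
    (h₂ : b ≤ a + d) : edist (a : EReal).toReal (b : EReal).toReal ≤ d := by
  rcases eq_or_ne d ∞ with rfl | hd
  · simp
  lift a to NNReal using ha
  lift b to NNReal using hb
  lift d to NNReal using hd
  norm_cast at h₁ h₂
  have h₁' : (a : ℝ) ≤ b + d := by exact_mod_cast h₁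
  have h₂' : (b : ℝ) ≤ a + d := by exact_mod_cast h₂
  rw [edist_dist, ENNReal.ofReal_le_iff_le_toReal (by simp), Real.dist_eq, abs_le]
  simp only [EReal.toReal_coe_ennreal, ENNReal.coe_toReal]
  constructor <;> linarith

/-! ### Almost everywhere finite functions -/

section LZero

variable {X : Type*} [MeasurableSpace X] {μ : Measure X}

theorem MemLZero.aemeasurable_abs {u : X → EReal} (hu : MemLZero μ u) :
    AEMeasurable (fun x => (u x).abs) μ :=
  EReal.measurable_abs.comp_aemeasurable hu.1

theorem MemLZero.ae_abs_ne_top {u : X → EReal} (hu : MemLZero μ u) :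
    ∀ᵐ x ∂μ, (u x).abs ≠ ∞ :=
  hu.2.mono fun _ hx => EReal.abs_ne_top_iff.2 hx

theorem memLZero_coe {F : X → ℝ≥0∞} (hF : AEMeasurable F μ) (h : ∀ᵐ x ∂μ, F x ≠ ∞) :
    MemLZero μ fun x => (F x : EReal) :=
  ⟨hF.coe_ereal_ennreal, h.mono fun x hx =>
    EReal.abs_ne_top_iff.1 (by rwa [EReal.abs_coe_ennreal])⟩

theorem lpNormEReal_coe {p : ℝ≥0∞} (F : X → ℝ≥0∞) :
    lpNormEReal μ p (fun x => (F x : EReal)) = eLpNorm F p μ := by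
  simp only [lpNormEReal, EReal.abs_coe_ennreal]
end LZero

/-! ### Gradient norms and majorants -/

section Space

variable {X : Type*} [MetricSpace X] [MeasurableSpace X] {μ : Measure X} {s : ℝ} {p : ℝ≥0∞}
  {Φ : (ℤ → X → ℝ≥0∞) → ℝ≥0∞}

/-- For `|u|` the gradient inequality can be written in `[0, ∞]` without subtraction, so such
inequalities can be summed over a series. -/
theorem IsFractionalGradient.exists_abs_le {u : X → EReal} {g : ℤ → X → ℝ≥0∞}
    (hg : IsFractionalGradient μ s u g) (hu : MemLZero μ u) :
    ∃ E : Set X, μ E = 0 ∧ (∀ x ∉ E, (u x).abs ≠ ∞) ∧ ∀ k : ℤ, ∀ x ∉ E, ∀ y ∉ E,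
      (2 : ℝ) ^ (-k - 1) ≤ dist x y → dist x y < (2 : ℝ) ^ (-k) →
      (u x).abs ≤ (u y).abs + ENNReal.ofReal (dist x y ^ s) * (g k x + g k y) := by
  obtain ⟨-, E, hE, h⟩ := hg
  refine ⟨E ∪ {x | ¬ (u x).abs ≠ ∞}, measure_union_null hE hu.ae_abs_ne_top, ?_, ?_⟩
  · intro x hx
    exact fun h' => hx (Or.inr (not_not.2 h'))
  · intro k x hx y hy h₁ h₂
    have hx' : (u x).abs ≠ ∞ := fun h' => hx (Or.inr (not_not.2 h'))
    have hy' : (u y).abs ≠ ∞ := fun h' => hy (Or.inr (not_not.2 h'))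
    refine (EReal.abs_le_abs_add_edist hx' hy').trans ?_
    gcongr
    exact h k x (fun h' => hx (Or.inl h')) y (fun h' => hy (Or.inl h')) h₁ h₂

theorem isFractionalGradient_coe {F : X → ℝ≥0∞} {g : ℤ → X → ℝ≥0∞}
    (hg : ∀ k, AEMeasurable (g k) μ) {E : Set X} (hE : μ E = 0) (hF : ∀ x ∉ E, F x ≠ ∞)
    (h : ∀ k : ℤ, ∀ x ∉ E, ∀ y ∉ E,
      (2 : ℝ) ^ (-k - 1) ≤ dist x y → dist x y < (2 : ℝ) ^ (-k) →
      F x ≤ F y + ENNReal.ofReal (dist x y ^ s) * (g k x + g k y)) :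
    IsFractionalGradient μ s (fun x => (F x : EReal)) g := by
  refine ⟨hg, E, hE, fun k x hx y hy h₁ h₂ => ?_⟩
  refine EReal.edist_toReal_coe_le (hF x hx) (hF y hy) (h k x hx y hy h₁ h₂) ?_
  have := h k y hy x hx (by rwa [dist_comm]) (by rwa [dist_comm])
  rwa [dist_comm, add_comm (g k y)] at this

/-- The norm associated with a functional `Φ` of fractional gradients. -/
def gradientSpaceNorm (μ : Measure X) (s : ℝ) (p : ℝ≥0∞) (Φ : (ℤ → X → ℝ≥0∞) → ℝ≥0∞)
    (u : X → EReal) : ℝ≥0∞ :=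
  lpNormEReal μ p u + ⨅ g ∈ {g | IsFractionalGradient μ s u g}, Φ g

theorem exists_gradient_of_norm_lt {u : X → EReal} {b : ℝ≥0∞}
    (h : gradientSpaceNorm μ s p Φ u < b) :
    ∃ g, IsFractionalGradient μ s u g ∧ lpNormEReal μ p u + Φ g < b := by
  rw [gradientSpaceNorm, ← lt_tsub_iff_left, iInf_lt_iff] at h
  obtain ⟨g, h⟩ := h
  obtain ⟨hg, h⟩ := iInf_lt_iff.1 h
  exact ⟨g, hg, lt_tsub_iff_left.1 h⟩

theorem norm_le_of_gradient {u : X → EReal} {g : ℤ → X → ℝ≥0∞}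
    (hg : IsFractionalGradient μ s u g) :
    gradientSpaceNorm μ s p Φ u ≤ lpNormEReal μ p u + Φ g :=
  add_le_add_right (iInf₂_le g hg) _

/-- Countable subadditivity of the norm. -/
theorem exists_majorant_of_tsum (hp : 1 ≤ p) (hΦ : IsGradientNorm μ p Φ) {u : ℕ → X → EReal}
    (hu : ∀ i, MemLZero μ (u i)) {c : ℕ → NNReal} {b : ℕ → ℝ≥0∞}
    (hb : ∀ i, gradientSpaceNorm μ s p Φ (u i) < b i) (hsum : ∑' i, (c i : ℝ≥0∞) * b i ≠ ∞) :
    ∃ F : X → ℝ≥0∞, (fun x => (F x : EReal)) ∈ spaceOf μ (gradientSpaceNorm μ s p Φ) ∧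
      gradientSpaceNorm μ s p Φ (fun x => (F x : EReal)) ≤ ∑' i, (c i : ℝ≥0∞) * b i ∧
      ∀ i x, (c i : ℝ≥0∞) * (u i x).abs ≤ F x := by
  choose g hg hgb using fun i => exists_gradient_of_norm_lt (hb i)
  choose E hE hEfin hEg using fun i => (hg i).exists_abs_le (hu i)
  set F : X → ℝ≥0∞ := fun x => ∑' i, (c i : ℝ≥0∞) * (u i x).abs with hF
  have hFm : AEMeasurable F μ :=
    AEMeasurable.tsum fun i => (hu i).aemeasurable_abs.const_mul _
  have hFp : eLpNorm F p μ ≤ ∑' i, (c i : ℝ≥0∞) * lpNormEReal μ p (u i) :=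
    (eLpNorm_tsum_le_tsum hp fun i => (hu i).aemeasurable_abs.const_mul _).trans <|
      ENNReal.tsum_le_tsum fun i => eLpNorm_nnreal_mul_le _ _
  have htotal : eLpNorm F p μ + Φ (fun k x => ∑' i, (c i : ℝ≥0∞) * g i k x) ≤
      ∑' i, (c i : ℝ≥0∞) * b i := by
    refine (add_le_add hFp (hΦ.tsum_le c g fun i => (hg i).1)).trans ?_
    rw [← ENNReal.tsum_add]
    refine ENNReal.tsum_le_tsum fun i => ?_
    rw [← mul_add]
    gcongr
    exact (hgb i).le
  -- Finiteness of the `L^p` norm is what places the series in `L⁰`.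
  have hFfin : ∀ᵐ x ∂μ, F x ≠ ∞ :=
    ae_ne_top_of_eLpNorm_ne_top (zero_lt_one.trans_le hp).ne' hFm
      ((le_self_add.trans htotal).trans_lt hsum.lt_top).ne
  have hgrad : IsFractionalGradient μ s (fun x => (F x : EReal))
      (fun k x => ∑' i, (c i : ℝ≥0∞) * g i k x) := by
    refine isFractionalGradient_coe
      (fun k => AEMeasurable.tsum fun i => ((hg i).1 k).const_mul _)
      (E := (⋃ i, E i) ∪ {x | ¬ F x ≠ ∞}) (measure_union_null (measure_iUnion_null hE) hFfin) ?_ ?_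
    · intro x hx h
      exact hx (Or.inr (not_not.2 h))
    · intro k x hx y hy h₁ h₂
      simp only [Set.mem_union, Set.mem_iUnion, not_or, not_exists] at hx hy
      simp only [hF]
      rw [← ENNReal.tsum_add, ← ENNReal.tsum_mul_left, ← ENNReal.tsum_add]
      refine ENNReal.tsum_le_tsum fun i => ?_
      calc (c i : ℝ≥0∞) * (u i x).abs
          ≤ c i * ((u i y).abs + ENNReal.ofReal (dist x y ^ s) * (g i k x + g i k y)) := by
            gcongr
            exact hEg i k x (hx.1 i) y (hy.1 i) h₁ h₂
        _ = _ := by ring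
  have hN : gradientSpaceNorm μ s p Φ (fun x => (F x : EReal)) ≤ ∑' i, (c i : ℝ≥0∞) * b i := by
    refine (norm_le_of_gradient hgrad).trans ?_
    rwa [lpNormEReal_coe]
  exact ⟨F, ⟨memLZero_coe hFm hFfin, hN.trans_lt hsum.lt_top⟩, hN,
    fun i x => ENNReal.le_tsum (f := fun i => (c i : ℝ≥0∞) * (u i x).abs) i⟩

theorem exists_majorant_of_pair (hp : 1 ≤ p) (hΦ : IsGradientNorm μ p Φ) {u v : X → EReal}
    (hu : MemLZero μ u) (hv : MemLZero μ v) {a b : ℝ≥0∞} (ha : a ≠ ∞) (hb : b ≠ ∞)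
    (hua : gradientSpaceNorm μ s p Φ u < a) (hvb : gradientSpaceNorm μ s p Φ v < b) :
    ∃ F : X → ℝ≥0∞, (fun x => (F x : EReal)) ∈ spaceOf μ (gradientSpaceNorm μ s p Φ) ∧
      gradientSpaceNorm μ s p Φ (fun x => (F x : EReal)) ≤ a + b ∧
      ∀ x, (u x).abs ≤ F x ∧ (v x).abs ≤ F x := by
  -- The pair is treated as a series with coefficients `1, 1, 0, 0, …`.
  have hsum : ∑' i : ℕ, ((if i < 2 then 1 else 0 : NNReal) : ℝ≥0∞) * (if i = 0 then a else b) =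
      a + b := by
    rw [tsum_eq_sum (s := Finset.range 2)]
    · simp [Finset.sum_range_succ]
    · intro i hi
      simp [show ¬ i < 2 by simpa using hi]
  obtain ⟨F, hF, hFN, hle⟩ := exists_majorant_of_tsum (s := s) hp hΦ
    (u := fun i => if i = 0 then u else v) (c := fun i => if i < 2 then 1 else 0)
    (b := fun i => if i = 0 then a else b) (fun i => by split_ifs <;> assumption)
    (fun i => by split_ifs <;> assumption) (by rw [hsum]; finiteness)
  exact ⟨F, hF, hsum ▸ hFN, fun x => ⟨by simpa using hle 0 x, by simpa using hle 1 x⟩⟩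

end Space

/-! ### Truncations tend to zero in norm -/

section Truncation

variable {X : Type*} [MetricSpace X] [MeasurableSpace X] {μ : Measure X} {s : ℝ} {p : ℝ≥0∞}
  {Φ : (ℤ → X → ℝ≥0∞) → ℝ≥0∞}

/-- The function `(|u| - 3n)₊`. -/
def upperTruncation {X : Type*} (u : X → EReal) (n : ℕ) (x : X) : ℝ≥0∞ :=
  (u x).abs - 3 * n

theorem upperTruncation_le {X : Type*} (u : X → EReal) (n : ℕ) (x : X) :
    upperTruncation u n x ≤ (u x).abs :=
  tsub_le_self

/-- Coefficients of a series giving a fractional gradient of `(|u| - 3n)₊`. -/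
def truncationCoeff (s : ℝ) : ℕ → NNReal
  | 0 => 2
  | i + 1 => Real.toNNReal (2 ^ (-s)) ^ i

/-- Terms of the series with coefficients `truncationCoeff` giving a fractional gradient of
`(|u| - 3n)₊`. -/
def truncationTerm {X : Type*} (u : X → EReal) (g : ℤ → X → ℝ≥0∞) (n : ℕ) : ℕ → ℤ → X → ℝ≥0∞
  | 0 => fun k => upperPart (g k) (fun x => (u x).abs) n
  | i + 1 => fun k x => if k = -1 - (i : ℤ) then upperTruncation u n x else 0

/-- If `a > 3n` while `b` and `g₂` are at most `n`, then `d ≤ 1` forces `g₁ ≥ n ≥ g₂`, so `2 g₁`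
absorbs the gradient at the other point. This explains the level `3n`, the factor `2`, and the
cut-off where either the gradient or the function exceeds `n`. -/
theorem upperTruncation_le_of_le_one {a b d g₁ g₂ t₁ t₂ : ℝ≥0∞} {n : ℕ} (hd : d ≤ 1)
    (h : a ≤ b + d * (g₁ + g₂))
    (ht₁ : (n : ℝ≥0∞) < g₁ ∨ (n : ℝ≥0∞) < a → 2 * g₁ ≤ t₁)
    (ht₂ : (n : ℝ≥0∞) < g₂ ∨ (n : ℝ≥0∞) < b → 2 * g₂ ≤ t₂) :
    a - 3 * n ≤ b - 3 * n + d * (t₁ + t₂) := by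
  rcases le_or_gt a (3 * n) with ha | ha
  · simp [tsub_eq_zero_of_le ha]
  have han : (n : ℝ≥0∞) < a := by
    refine lt_of_le_of_lt ?_ ha
    exact_mod_cast (by omega : n ≤ 3 * n)
  have h₁ := ht₁ (Or.inr han)
  have main : g₁ + g₂ ≤ t₁ + t₂ := by
    by_cases h' : (n : ℝ≥0∞) < g₂ ∨ (n : ℝ≥0∞) < b
    · have h₂ := ht₂ h'
      rw [two_mul] at h₁ h₂
      exact add_le_add (le_self_add.trans h₁) (le_self_add.trans h₂)
    · rw [not_or, not_lt, not_lt] at h'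
      have hg : (n : ℝ≥0∞) ≤ g₁ := by
        by_contra hg
        rw [not_le] at hg
        refine ha.not_ge (h.trans ?_)
        calc b + d * (g₁ + g₂) ≤ n + 1 * (n + n) := by
              gcongr
              · exact h'.2
              · exact h'.1
          _ = 3 * n := by ring
      refine le_trans ?_ (h₁.trans le_self_add)
      rw [two_mul]
      gcongr
      exact h'.1.trans hg
  rw [tsub_le_iff_right]
  calc a ≤ b + d * (g₁ + g₂) := h
    _ ≤ (b - 3 * n + 3 * n) + d * (t₁ + t₂) := by
      gcongr
      exact le_tsub_add
    _ = _ := by ring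

theorem one_le_ofReal_mul_pow {d : ℝ} (hs : 0 < s) {i : ℕ} (hd : 2 ^ i ≤ d) :
    1 ≤ ENNReal.ofReal (d ^ s) * ((Real.toNNReal (2 ^ (-s)) ^ i : NNReal) : ℝ≥0∞) := by
  have h2 : (0 : ℝ) ≤ 2 ^ (-s) := by positivity
  rw [ENNReal.coe_pow, ENNReal.ofNNReal_toNNReal, ← ENNReal.ofReal_pow h2,
    ← ENNReal.ofReal_mul (Real.rpow_nonneg ((by positivity : (0 : ℝ) ≤ 2 ^ i).trans hd) _),
    ← ENNReal.ofReal_one]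
  refine ENNReal.ofReal_le_ofReal ?_
  have h3 : ((2 : ℝ) ^ i) ^ s ≤ d ^ s := Real.rpow_le_rpow (by positivity) hd hs.le
  have h4 : ((2 : ℝ) ^ i) ^ s * (2 ^ (-s)) ^ i = 1 := by
    rw [← Real.rpow_natCast, ← Real.rpow_natCast, ← Real.rpow_mul (by norm_num),
      ← Real.rpow_mul (by norm_num), ← Real.rpow_add (by norm_num)]
    ring_nf
    simp
  rw [← h4]
  gcongr

/-- Below distance `1` the doubled cut-off gradient works. At distance at least `2ⁱ` the function
itself times `2^(-si)` is a gradient, since it is nonnegative and `d^s 2^(-si) ≥ 1`. -/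
theorem isFractionalGradient_upperTruncation (hs : 0 < s) {u : X → EReal} (hu : MemLZero μ u)
    {g : ℤ → X → ℝ≥0∞} (hg : IsFractionalGradient μ s u g) (n : ℕ) :
    (∀ i k, AEMeasurable (truncationTerm u g n i k) μ) ∧
    IsFractionalGradient μ s (fun x => (upperTruncation u n x : EReal))
      (fun k x => ∑' i, (truncationCoeff s i : ℝ≥0∞) * truncationTerm u g n i k x) := by
  have hfm : AEMeasurable (upperTruncation u n) μ := hu.aemeasurable_abs.sub aemeasurable_const
  have hm : ∀ i k, AEMeasurable (truncationTerm u g n i k) μ := by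
    intro i k
    cases i with
    | zero => exact (hg.1 k).upperPart hu.aemeasurable_abs n
    | succ i =>
      by_cases h : k = -1 - (i : ℤ)
      · simpa only [truncationTerm, h, if_true] using hfm
      · simpa only [truncationTerm, h, if_false] using aemeasurable_const
  refine ⟨hm, ?_⟩
  obtain ⟨E, hE, hfin, h⟩ := hg.exists_abs_le hu
  refine isFractionalGradient_coe (fun k => AEMeasurable.tsum fun i => (hm i k).const_mul _) hE
    (fun x hx => ((upperTruncation_le u n x).trans_lt (hfin x hx).lt_top).ne) ?_
  intro k x hx y hy h₁ h₂
  have hterm : ∀ i z, (truncationCoeff s i : ℝ≥0∞) * truncationTerm u g n i k z ≤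
      ∑' i, (truncationCoeff s i : ℝ≥0∞) * truncationTerm u g n i k z := fun i z =>
    ENNReal.le_tsum (f := fun i => (truncationCoeff s i : ℝ≥0∞) * truncationTerm u g n i k z) i
  rcases le_or_gt 0 k with hk | hk
  · refine upperTruncation_le_of_le_one ?_ (h k x hx y hy h₁ h₂) (fun h' => ?_) (fun h' => ?_)
    · rw [← ENNReal.ofReal_one]
      refine ENNReal.ofReal_le_ofReal (Real.rpow_le_one dist_nonneg ?_ hs.le)
      exact h₂.le.trans (zpow_le_one_of_nonpos₀ (by norm_num) (by omega))
    · refine le_trans (le_of_eq ?_) (hterm 0 x)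
      simp [truncationCoeff, truncationTerm, upperPart, h']
    · refine le_trans (le_of_eq ?_) (hterm 0 y)
      simp [truncationCoeff, truncationTerm, upperPart, h']
  -- The scale `k = -1 - i` is the ring of distances in `[2ⁱ, 2ⁱ⁺¹)`.
  · obtain ⟨i, rfl⟩ : ∃ i : ℕ, k = -1 - (i : ℤ) := ⟨(-1 - k).toNat, by omega⟩
    have hd : (2 : ℝ) ^ i ≤ dist x y := by
      have : (-(-1 - (i : ℤ)) - 1) = (i : ℤ) := by ring
      rwa [this, zpow_natCast] at h₁
    have hx' := hterm (i + 1) x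
    simp only [truncationCoeff, truncationTerm, if_true] at hx'
    calc upperTruncation u n x = 1 * upperTruncation u n x := (one_mul _).symm
      _ ≤ ENNReal.ofReal (dist x y ^ s) *
          ((Real.toNNReal (2 ^ (-s)) ^ i : NNReal) : ℝ≥0∞) * upperTruncation u n x := by
            gcongr
            exact one_le_ofReal_mul_pow hs hd
      _ ≤ _ := by
            rw [mul_assoc]
            refine le_trans ?_ le_add_self
            gcongr
            exact hx'.trans le_self_add

theorem norm_upperTruncation_le (hs : 0 < s) (hΦ : IsGradientNorm μ p Φ) {u : X → EReal}
    (hu : MemLZero μ u) {g : ℤ → X → ℝ≥0∞} (hg : IsFractionalGradient μ s u g) (n : ℕ) :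
    gradientSpaceNorm μ s p Φ (fun x => (upperTruncation u n x : EReal)) ≤
      eLpNorm (upperTruncation u n) p μ +
        (2 * Φ (fun k => upperPart (g k) (fun x => (u x).abs) n) +
          (1 - ENNReal.ofReal (2 ^ (-s)))⁻¹ * eLpNorm (upperTruncation u n) p μ) := by
  obtain ⟨hm, hgrad⟩ := isFractionalGradient_upperTruncation hs hu hg n
  refine (norm_le_of_gradient hgrad).trans ?_
  rw [lpNormEReal_coe]
  gcongr
  refine (hΦ.tsum_le _ _ hm).trans ?_
  rw [tsum_eq_zero_add' ENNReal.summable]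
  gcongr ?_ + ?_
  · simp [truncationCoeff, truncationTerm]
  -- Each large scale contributes one single-term sequence, and the coefficients form a geometric
  -- series of ratio `2^(-s) < 1`.
  · rw [← ENNReal.tsum_geometric, ← ENNReal.tsum_mul_right]
    refine ENNReal.tsum_le_tsum fun i => ?_
    simp only [truncationCoeff, truncationTerm, ENNReal.coe_pow]
    gcongr
    · exact le_rfl
    · exact hΦ.single_le _ _

/-- The truncations `(|u| - 3n)₊` of a function of the space tend to zero in norm. -/
theorem tendsto_norm_upperTruncation (hp₁ : 1 ≤ p) (hp : p ≠ ∞) (hs : 0 < s)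
    (hΦ : IsGradientNorm μ p Φ) {u : X → EReal}
    (hu : u ∈ spaceOf μ (gradientSpaceNorm μ s p Φ)) :
    (∀ n, (fun x => (upperTruncation u n x : EReal)) ∈ spaceOf μ (gradientSpaceNorm μ s p Φ)) ∧
    Tendsto (fun n => gradientSpaceNorm μ s p Φ fun x => (upperTruncation u n x : EReal))
      atTop (𝓝 0) := by
  have hp0 : p ≠ 0 := (zero_lt_one.trans_le hp₁).ne'
  obtain ⟨g, hg, hgfin⟩ := exists_gradient_of_norm_lt hu.2
  have hu0 := hu.1
  have hΦg : Φ g ≠ ∞ := (le_add_self.trans_lt hgfin).ne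
  have hup : eLpNorm (fun x => (u x).abs) p μ ≠ ∞ := (le_self_add.trans_lt hgfin).ne
  have hr : (1 - ENNReal.ofReal (2 ^ (-s)))⁻¹ ≠ ∞ := by
    rw [ENNReal.inv_ne_top, ← pos_iff_ne_zero, tsub_pos_iff_lt, ENNReal.ofReal_lt_one]
    exact Real.rpow_lt_one_of_one_lt_of_neg (by norm_num) (by linarith)
  have hfm : ∀ n, AEMeasurable (upperTruncation u n) μ := fun n =>
    hu0.aemeasurable_abs.sub aemeasurable_const
  have hfp : ∀ n, eLpNorm (upperTruncation u n) p μ ≤ eLpNorm (fun x => (u x).abs) p μ :=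
    fun n => eLpNorm_mono_ennreal (upperTruncation_le u n)
  constructor
  · intro n
    refine ⟨memLZero_coe (hfm n) (hu0.ae_abs_ne_top.mono fun x hx =>
      ((upperTruncation_le u n x).trans_lt hx.lt_top).ne), ?_⟩
    have h₁ : eLpNorm (upperTruncation u n) p μ ≠ ∞ := ((hfp n).trans_lt hup.lt_top).ne
    have h₂ : Φ (fun k => upperPart (g k) (fun x => (u x).abs) n) ≠ ∞ :=
      ((hΦ.mono _ _ fun k x => upperPart_le _ _ _ _).trans_lt hΦg.lt_top).ne
    refine (norm_upperTruncation_le hs hΦ hu0 hg n).trans_lt ?_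
    finiteness
  · have h₁ : Tendsto (fun n => eLpNorm (upperTruncation u n) p μ) atTop (𝓝 0) := by
      refine tendsto_eLpNorm_zero_of_dominated hp0 hp hfm (upperTruncation_le u) hup ?_
      filter_upwards [hu0.ae_abs_ne_top] with x hx
      obtain ⟨n, hn⟩ := ENNReal.exists_nat_gt hx
      refine tendsto_const_nhds.congr' ?_
      filter_upwards [eventually_ge_atTop n] with j hj
      refine (tsub_eq_zero_of_le (hn.le.trans ?_)).symm
      exact_mod_cast (by omega : n ≤ 3 * j)
    have h₂ := hΦ.tendsto_upperPart g (fun x => (u x).abs) hg.1 hu0.aemeasurable_abs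
      hu0.ae_abs_ne_top hΦg
    have h₃ := h₁.add ((ENNReal.Tendsto.const_mul h₂ (Or.inr (by simp : (2 : ℝ≥0∞) ≠ ∞))).add
      (ENNReal.Tendsto.const_mul h₁ (Or.inr hr)))
    simp only [mul_zero, add_zero] at h₃
    exact tendsto_of_tendsto_of_tendsto_of_le_of_le tendsto_const_nhds h₃ (fun n => zero_le)
      (fun n => norm_upperTruncation_le hs hΦ hu0 hg n)

end Truncation

/-! ### Subadditivity and Borel–Cantelli for the capacity -/

section Capacity

variable {X : Type*} [MetricSpace X] [MeasurableSpace X] {μ : Measure X} {s : ℝ} {p : ℝ≥0∞}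
  {Φ : (ℤ → X → ℝ≥0∞) → ℝ≥0∞} {N : (X → EReal) → ℝ≥0∞}

theorem capacity_mono {E E' : Set X} (h : E ⊆ E') : capacity μ N p E ≤ capacity μ N p E' :=
  le_iInf₂ fun u ⟨hu, U, hU, hEU, h1⟩ => iInf₂_le u ⟨hu, U, hU, h.trans hEU, h1⟩

theorem capacity_le_of_isOpen {U : Set X} (hU : IsOpen U) {F : X → ℝ≥0∞}
    (hF : (fun x => (F x : EReal)) ∈ spaceOf μ N) (h : ∀ x ∈ U, 1 ≤ F x) {b : ℝ≥0∞}
    (hb : N (fun x => (F x : EReal)) ≤ b) : capacity μ N p U ≤ b ^ p.toReal :=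
  (iInf₂_le _ ⟨hF, U, hU, subset_rfl, fun x hx => by exact_mod_cast h x hx⟩).trans <| by gcongr

theorem exists_of_capacity_lt (hp₁ : 1 ≤ p) (hp : p ≠ ∞) {E : Set X} {b : ℝ≥0∞}
    (h : capacity μ N p E < b ^ p.toReal) :
    ∃ u ∈ spaceOf μ N, N u < b ∧ ∃ U, IsOpen U ∧ E ⊆ U ∧ ∀ x ∈ U, 1 ≤ (u x).abs := by
  have hpos : 0 < p.toReal := ENNReal.toReal_pos (zero_lt_one.trans_le hp₁).ne' hp
  obtain ⟨u, h⟩ := iInf_lt_iff.1 h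
  obtain ⟨⟨hu, U, hU, hEU, h1⟩, h⟩ := iInf_lt_iff.1 h
  exact ⟨u, hu, (ENNReal.rpow_lt_rpow_iff hpos).1 h, U, hU, hEU,
    fun x hx => EReal.one_le_abs (h1 x hx)⟩

/-- Countable subadditivity of the `p`-th root of the capacity. -/
theorem capacity_iUnion_le (hp₁ : 1 ≤ p) (hp : p ≠ ∞) (hΦ : IsGradientNorm μ p Φ)
    {E : ℕ → Set X} {b : ℕ → ℝ≥0∞}
    (h : ∀ i, capacity μ (gradientSpaceNorm μ s p Φ) p (E i) < b i ^ p.toReal)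
    (hb : ∑' i, b i ≠ ∞) :
    capacity μ (gradientSpaceNorm μ s p Φ) p (⋃ i, E i) ≤ (∑' i, b i) ^ p.toReal := by
  choose u hu hub U hU hEU h1 using fun i => exists_of_capacity_lt hp₁ hp (h i)
  obtain ⟨F, hF, hFN, hle⟩ := exists_majorant_of_tsum (s := s) hp₁ hΦ (fun i => (hu i).1)
    (c := fun _ => 1) hub (by simpa using hb)
  refine (capacity_mono (Set.iUnion_mono hEU)).trans
    (capacity_le_of_isOpen (isOpen_iUnion hU) hF ?_ (by simpa using hFN))
  intro x hx
  obtain ⟨i, hi⟩ := Set.mem_iUnion.1 hx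
  exact (h1 i x hi).trans (by simpa using hle i x)

/-- Borel–Cantelli: the `p`-th roots of the capacities have geometric tails. -/
theorem capacity_limsup_eq_zero (hp₁ : 1 ≤ p) (hp : p ≠ ∞) (hΦ : IsGradientNorm μ p Φ)
    {E : ℕ → Set X} (h : ∀ i, capacity μ (gradientSpaceNorm μ s p Φ) p (E i) <
      ((2 : ℝ≥0∞)⁻¹ ^ i) ^ p.toReal) :
    capacity μ (gradientSpaceNorm μ s p Φ) p (⋂ n, ⋃ i, E (n + i)) = 0 := by
  have hpos : 0 < p.toReal := ENNReal.toReal_pos (zero_lt_one.trans_le hp₁).ne' hp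
  have hsum : ∀ n : ℕ, ∑' i, (2 : ℝ≥0∞)⁻¹ ^ (n + i) = (2 : ℝ≥0∞)⁻¹ ^ n * 2 := by
    intro n
    simp_rw [pow_add]
    rw [ENNReal.tsum_mul_left, ENNReal.tsum_geometric, ENNReal.one_sub_inv_two, inv_inv]
  have hle : ∀ n, capacity μ (gradientSpaceNorm μ s p Φ) p (⋂ n, ⋃ i, E (n + i)) ≤
      ((2 : ℝ≥0∞)⁻¹ ^ n * 2) ^ p.toReal := by
    intro n
    rw [← hsum]
    refine (capacity_mono (Set.iInter_subset _ n)).trans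
      (capacity_iUnion_le hp₁ hp hΦ (fun i => h (n + i)) ?_)
    rw [hsum]
    finiteness
  have hlim : Tendsto (fun n : ℕ => ((2 : ℝ≥0∞)⁻¹ ^ n * 2) ^ p.toReal) atTop (𝓝 0) := by
    have h1 := ENNReal.tendsto_pow_atTop_nhds_zero_of_lt_one
      (ENNReal.inv_lt_one.2 ENNReal.one_lt_two)
    have h2 := (ENNReal.Tendsto.mul_const h1
      (Or.inr (by simp : (2 : ℝ≥0∞) ≠ ∞))).ennrpow_const p.toReal
    simpa [hpos] using h2
  exact le_antisymm (ge_of_tendsto' hlim hle) zero_le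

theorem capacity_union_eq_zero (hp₁ : 1 ≤ p) (hp : p ≠ ∞) (hΦ : IsGradientNorm μ p Φ)
    {E E' : Set X} (h : capacity μ (gradientSpaceNorm μ s p Φ) p E = 0)
    (h' : capacity μ (gradientSpaceNorm μ s p Φ) p E' = 0) :
    capacity μ (gradientSpaceNorm μ s p Φ) p (E ∪ E') = 0 := by
  have hpos : 0 < p.toReal := ENNReal.toReal_pos (zero_lt_one.trans_le hp₁).ne' hp
  -- The upper limit of the alternating sequence `E, E', E, …` contains the union.
  have key := capacity_limsup_eq_zero (E := fun i => if Even i then E else E') hp₁ hp hΦ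
    fun i => by
      have : (0 : ℝ≥0∞) < ((2 : ℝ≥0∞)⁻¹ ^ i) ^ p.toReal :=
        ENNReal.rpow_pos (ENNReal.pow_pos (by simp) i) (by finiteness)
      split_ifs
      · rwa [h]
      · rwa [h']
  refine le_antisymm ((capacity_mono ?_).trans key.le) zero_le
  refine Set.subset_iInter fun n => Set.union_subset ?_ ?_
  · exact fun x hx => Set.mem_iUnion.2 ⟨n, by simpa⟩
  · exact fun x hx => Set.mem_iUnion.2 ⟨n + 1, by
      rwa [if_neg (by rw [← add_assoc, Nat.not_even_iff_odd]; exact ⟨n, by ring⟩)]⟩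

end Capacity

/-! ### `M^{s,p}` as `M^s_{p,∞}` -/

section Hajlasz

variable {X : Type*} [MetricSpace X] [MeasurableSpace X] {μ : Measure X} {s : ℝ}

theorem IsFractionalGradient.isSGradient_iSup {u : X → EReal} {g : ℤ → X → ℝ≥0∞}
    (hg : IsFractionalGradient μ s u g) : IsSGradient μ s u fun x => ⨆ k, g k x := by
  obtain ⟨hm, E, hE, h⟩ := hg
  refine ⟨AEMeasurable.iSup hm, E, hE, fun x hx y hy => ?_⟩
  rcases eq_or_ne x y with rfl | hxy
  · simp
  obtain ⟨n, hn₁, hn₂⟩ := exists_mem_Ico_zpow (dist_pos.2 hxy) (one_lt_two (α := ℝ))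
  -- The distance range `[2ⁿ, 2ⁿ⁺¹)` has index `k = -n - 1`.
  have e₁ : (-(-n - 1) - 1) = n := by ring
  have e₂ : -(-n - 1) = n + 1 := by ring
  refine (h (-n - 1) x hx y hy (by rwa [e₁]) (by rwa [e₂])).trans ?_
  gcongr
  · exact le_iSup (fun k => g k x) _
  · exact le_iSup (fun k => g k y) _

theorem IsSGradient.isFractionalGradient {u : X → EReal} {g : X → ℝ≥0∞}
    (hg : IsSGradient μ s u g) : IsFractionalGradient μ s u fun _ => g := by
  obtain ⟨hm, E, hE, h⟩ := hg
  exact ⟨fun _ => hm, E, hE, fun _ x hx y hy _ _ => h x hx y hy⟩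

/-- The Hajłasz space `M^{s,p}` is `M^s_{p,∞}`, with equal norms. -/
theorem hajlaszNorm_eq (μ : Measure X) (s : ℝ) (p : ℝ≥0∞) :
    hajlaszNorm μ s p = triebelLizorkinNorm μ s p ∞ := by
  ext u
  unfold hajlaszNorm triebelLizorkinNorm
  simp only [lqNorm_top]
  congr 1
  refine le_antisymm (le_iInf₂ fun g hg => iInf₂_le _ hg.isSGradient_iSup) ?_
  refine le_iInf₂ fun g hg => (iInf₂_le _ hg.isFractionalGradient).trans ?_
  simp

end Hajlasz

/-! ### Elementary bounds for the maximal function -/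

section MaximalFunction

variable {X : Type*} [MeasurableSpace X] {μ : Measure X} {𝓑 : X → Set (Set X)}

theorem laverage_le_maximalFunction {u : X → EReal} {x : X} {B : Set X} (hB : B ∈ ⋃ y, 𝓑 y)
    (hx : x ∈ B) : ⨍⁻ y in B, (u y).abs ∂μ ≤ maximalFunction μ 𝓑 u x :=
  le_iSup₂ (f := fun (B : Set X) (_ : B ∈ {B | B ∈ ⋃ y, 𝓑 y ∧ x ∈ B}) =>
    ⨍⁻ y in B, (u y).abs ∂μ) B ⟨hB, hx⟩

theorem setLAverage_const_mul (c : NNReal) (B : Set X) (f : X → ℝ≥0∞) :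
    ⨍⁻ y in B, (c : ℝ≥0∞) * f y ∂μ = c * ⨍⁻ y in B, f y ∂μ := by
  rw [setLAverage_eq, setLAverage_eq, lintegral_const_mul' _ _ ENNReal.coe_ne_top, mul_div_assoc]

theorem mul_maximalFunction_le {u : X → EReal} {F : X → ℝ≥0∞} {c : NNReal}
    (h : ∀ x, (c : ℝ≥0∞) * (u x).abs ≤ F x) (x : X) :
    (c : ℝ≥0∞) * maximalFunction μ 𝓑 u x ≤ maximalFunction μ 𝓑 (fun x => (F x : EReal)) x := by
  unfold maximalFunction
  simp only [ENNReal.mul_iSup, ← setLAverage_const_mul, EReal.abs_coe_ennreal]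
  exact iSup₂_mono fun B hB => laverage_mono_ae (Eventually.of_forall h)

end MaximalFunction

/-! ### (1) ⇒ (2) -/

section WeakEstimate

variable {X : Type*} [MetricSpace X] [MeasurableSpace X] {μ : Measure X} {s : ℝ} {p : ℝ≥0∞}
  {Φ : (ℤ → X → ℝ≥0∞) → ℝ≥0∞} {𝓑 : X → Set (Set X)}

/-- If the superlevel sets of each maximal function have small capacity, then the maximal operator
is continuous at zero in capacity. -/
theorem tendsto_capacity_maximalFunction (hp₁ : 1 ≤ p) (hΦ : IsGradientNorm μ p Φ)
    (H : ∀ u ∈ spaceOf μ (gradientSpaceNorm μ s p Φ),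
      Tendsto (fun t : ℝ => capacity μ (gradientSpaceNorm μ s p Φ) p
        {x | ENNReal.ofReal t < maximalFunction μ 𝓑 u x}) atTop (𝓝 0))
    {t : ℝ} (ht : 0 < t) {u : ℕ → X → EReal}
    (hu : ∀ k, u k ∈ spaceOf μ (gradientSpaceNorm μ s p Φ))
    (hlim : Tendsto (fun k => gradientSpaceNorm μ s p Φ (u k)) atTop (𝓝 0)) :
    Tendsto (fun k => capacity μ (gradientSpaceNorm μ s p Φ) p
      {x | ENNReal.ofReal t < maximalFunction μ 𝓑 (u k) x}) atTop (𝓝 0) := by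
  rw [ENNReal.tendsto_nhds_zero]
  by_contra hcon
  push Not at hcon
  obtain ⟨δ, hδ, hfreq⟩ := hcon
  have hex : ∀ i : ℕ, ∃ k, δ < capacity μ (gradientSpaceNorm μ s p Φ) p
      {x | ENNReal.ofReal t < maximalFunction μ 𝓑 (u k) x} ∧
      gradientSpaceNorm μ s p Φ (u k) < (4 : ℝ≥0∞)⁻¹ ^ i := fun i =>
    (hfreq.and_eventually (hlim.eventually_lt_const (ENNReal.pow_pos (by simp) i))).exists
  choose φ hφ hφN using hex
  -- The weights `2ⁱ` grow without bound, yet against norms below `4⁻ⁱ` they leave a convergent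
  -- series.
  have hterm : ∀ i : ℕ, (((2 : NNReal) ^ i : NNReal) : ℝ≥0∞) * (4 : ℝ≥0∞)⁻¹ ^ i =
      (2 : ℝ≥0∞)⁻¹ ^ i := by
    intro i
    rw [ENNReal.coe_pow, ← mul_pow]
    congr 1
    rw [show (4 : ℝ≥0∞) = 2 * 2 by norm_num, ENNReal.mul_inv (by simp) (by simp), ← mul_assoc]
    simp [ENNReal.mul_inv_cancel]
  obtain ⟨F, hF, -, hle⟩ := exists_majorant_of_tsum (s := s) hp₁ hΦ (fun i => (hu (φ i)).1)
    (c := fun i => 2 ^ i) hφN (by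
      simp_rw [hterm, ENNReal.tsum_geometric, ENNReal.one_sub_inv_two]
      simp)
  have hH := H _ hF
  have hpow : Tendsto (fun i : ℕ => (2 : ℝ) ^ i * t) atTop atTop :=
    (tendsto_pow_atTop_atTop_of_one_lt one_lt_two).atTop_mul_const ht
  obtain ⟨i, hi⟩ := ((hH.comp hpow).eventually_lt_const hδ).exists
  refine lt_asymm hi ((hφ i).trans_le (capacity_mono fun x hx => ?_))
  refine lt_of_lt_of_le ?_ (mul_maximalFunction_le (hle i) x)
  rw [ENNReal.ofReal_mul (by positivity), ENNReal.ofReal_pow (by norm_num), ENNReal.coe_pow]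
  simp only [ENNReal.ofReal_ofNat, ENNReal.coe_ofNat]
  exact (ENNReal.mul_lt_mul_iff_right (by positivity) (by finiteness)).2 hx

end WeakEstimate

/-! ### Clamping and Tietze extension -/

section Clamp

/-- Truncation of an extended real number to `[-L, L]`. -/
def clampToReal (L : ℝ) (z : EReal) : ℝ := (max (-L : ℝ) (min (L : ℝ) z) : EReal).toReal

theorem continuous_clampToReal (L : ℝ) : Continuous (clampToReal L) := by
  refine EReal.continuousOn_toReal.comp_continuous (by fun_prop) fun z => ?_
  simp only [Set.mem_compl_iff, Set.mem_insert_iff, Set.mem_singleton_iff, not_or]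
  constructor
  · exact (lt_of_lt_of_le (EReal.bot_lt_coe _) (le_max_left _ _)).ne'
  · exact (max_lt (EReal.coe_lt_top _) (min_lt_of_left_lt (EReal.coe_lt_top _))).ne

theorem clampToReal_coe (L r : ℝ) : clampToReal L r = max (-L) (min L r) := by
  simp only [clampToReal]
  norm_cast

theorem abs_clampToReal_le {L : ℝ} (hL : 0 ≤ L) (z : EReal) : |clampToReal L z| ≤ L := by
  induction z with
  | bot => simp [clampToReal, abs_of_nonneg hL]
  | top =>
    have : ((-L : ℝ) : EReal) ≤ (L : ℝ) := by exact_mod_cast (by linarith : -L ≤ L)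
    simp only [clampToReal, min_eq_left le_top, max_eq_right this, EReal.toReal_coe]
    exact (abs_of_nonneg hL).le
  | coe r =>
    rw [clampToReal_coe, abs_le]
    exact ⟨le_max_left _ _, max_le (by linarith) (min_le_left _ _)⟩

/-- The clamping error is `(|z| - L)₊`, so for `L ≥ 3n` it is bounded by the truncation at level
`3n`. -/
theorem edist_clampToReal_le {L : ℝ} (hL : 0 ≤ L) {z : EReal} (hz : z.abs ≠ ∞) :
    edist z.toReal (clampToReal L z) ≤ z.abs - ENNReal.ofReal L := by
  rw [EReal.abs_ne_top_iff] at hz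
  lift z to ℝ using hz
  rw [EReal.abs_def, ← ENNReal.ofReal_sub _ hL, clampToReal_coe, EReal.toReal_coe, edist_dist,
    Real.dist_eq]
  rcases le_total z (-L) with h | h
  · rw [max_eq_left (min_le_of_right_le h), abs_of_nonpos (by linarith : z - -L ≤ 0),
      abs_of_nonpos (by linarith : z ≤ 0)]
    exact ENNReal.ofReal_le_ofReal (by linarith)
  · rcases le_total z L with h' | h'
    · rw [min_eq_right h', max_eq_right h]
      simp
    · rw [min_eq_left h', max_eq_right (by linarith), abs_of_nonneg (by linarith : 0 ≤ z - L),
        abs_of_nonneg (by linarith : 0 ≤ z)]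

theorem abs_le_ofReal_iff {L : ℝ} (hL : 0 ≤ L) {z : EReal} :
    z.abs ≤ ENNReal.ofReal L ↔ z ∈ Set.Icc ((-L : ℝ) : EReal) (L : ℝ) := by
  induction z with
  | bot => simp
  | top => simp
  | coe r =>
    rw [EReal.abs_def, ENNReal.ofReal_le_ofReal_iff hL, Set.mem_Icc, EReal.coe_le_coe_iff,
      EReal.coe_le_coe_iff, abs_le]

theorem toReal_eq_clampToReal {L : ℝ} (hL : 0 ≤ L) {z : EReal} (hz : z.abs ≤ ENNReal.ofReal L) :
    z.toReal = clampToReal L z := by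
  have h := edist_clampToReal_le hL (hz.trans_lt ENNReal.ofReal_lt_top).ne
  rwa [tsub_eq_zero_of_le hz, nonpos_iff_eq_zero, edist_eq_zero] at h

/-- A function continuous off an open set `U` agrees off `U`, up to truncation, with a bounded
continuous function. -/
theorem exists_continuous_eq_clampToReal {X : Type*} [MetricSpace X] {u : X → EReal} {U : Set X}
    (hU : IsOpen U) (hu : ContinuousOn u Uᶜ) {L : ℝ} (hL : 0 ≤ L) :
    ∃ h : X → ℝ, Continuous h ∧ (∀ x, |h x| ≤ L) ∧ ∀ x ∉ U, h x = clampToReal L (u x) := by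
  have hc : ContinuousOn (fun x => clampToReal L (u x)) Uᶜ :=
    (continuous_clampToReal L).comp_continuousOn hu
  have : Set.OrdConnected (Set.Icc (-L) L) := Set.ordConnected_Icc
  -- Tietze's theorem on the closed set `Uᶜ`, keeping the values in `[-L, L]`.
  obtain ⟨h, hh, hh'⟩ := ContinuousMap.exists_restrict_eq_forall_mem_of_closed
    (⟨_, continuousOn_iff_continuous_domRestrict.1 hc⟩ : C((Uᶜ : Set X), ℝ)) (t := Set.Icc (-L) L)
    (fun x => abs_le.1 (abs_clampToReal_le hL _)) ⟨0, by simpa using hL⟩ hU.isClosed_compl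
  refine ⟨h, h.continuous, fun x => abs_le.2 (hh x), fun x hx => ?_⟩
  exact DFunLike.congr_fun hh' (⟨x, hx⟩ : (Uᶜ : Set X))

end Clamp

/-- Integrability of `w` follows from the finite bound, so the integral is not the default value `0`
of a nonintegrable function. -/
theorem edist_integral_le {X : Type*} [MeasurableSpace X] {ν : Measure X} [IsProbabilityMeasure ν]
    {w : X → ℝ} (hw : AEMeasurable w ν) (r : ℝ) {φ : X → ℝ≥0∞}
    (hφ : ∀ᵐ y ∂ν, edist (w y) r ≤ φ y) (hfin : ∫⁻ y, φ y ∂ν ≠ ∞) :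
    edist (∫ y, w y ∂ν) r ≤ ∫⁻ y, φ y ∂ν := by
  have hφ' : ∀ᵐ y ∂ν, ‖w y - r‖ₑ ≤ φ y := by simpa [edist_eq_enorm_sub] using hφ
  have hint : Integrable (fun y => w y - r) ν :=
    ⟨(hw.sub_const r).aestronglyMeasurable, (lintegral_mono_ae hφ').trans_lt hfin.lt_top⟩
  have hwint : Integrable w ν := by
    refine (hint.add (integrable_const r)).congr (Eventually.of_forall fun y => ?_)
    simp
  have heq : ∫ y, w y ∂ν - r = ∫ y, (w y - r) ∂ν := by
    rw [integral_sub hwint (integrable_const r)]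
    simp
  rw [edist_eq_enorm_sub, heq]
  exact (enorm_integral_le_lintegral_enorm _).trans (lintegral_mono_ae hφ')

/-- An average of `w` is as close to `r` as the average of a pointwise bound for `|w - r|`. -/
theorem edist_average_le {X : Type*} [MeasurableSpace X] {μ : Measure X} {B : Set X}
    (hB₀ : μ B ≠ 0) (hB : μ B ≠ ∞) {w : X → ℝ} (hw : AEMeasurable w μ) (r : ℝ) {φ : X → ℝ≥0∞}
    (hφ : ∀ᵐ y ∂μ.restrict B, edist (w y) r ≤ φ y) (hfin : ⨍⁻ y in B, φ y ∂μ ≠ ∞) :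
    edist (⨍ y in B, w y ∂μ) r ≤ ⨍⁻ y in B, φ y ∂μ := by
  have : IsFiniteMeasure (μ.restrict B) := ⟨by simpa using hB.lt_top⟩
  have : NeZero (μ.restrict B) := ⟨by simpa [Measure.restrict_eq_zero] using hB₀⟩
  have : IsProbabilityMeasure ((μ.restrict B Set.univ)⁻¹ • μ.restrict B) := inferInstance
  exact edist_integral_le (hw.restrict.smul_measure _) r (Measure.ae_smul_measure hφ _) hfin

/-! ### (2) ⇒ (3) -/

section Lebesgue

variable {X : Type*} [MetricSpace X] [MeasurableSpace X] {μ : Measure X} {s : ℝ} {p : ℝ≥0∞}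
  {Φ : (ℤ → X → ℝ≥0∞) → ℝ≥0∞} {𝓑 : X → Set (Set X)}

theorem eventually_basisFilter {X : Type*} [MetricSpace X] {𝓑 : X → Set (Set X)} (x : X)
    {δ : ℝ} (hδ : 0 < δ) :
    ∀ᶠ B in basisFilter 𝓑 x, B ∈ 𝓑 x ∧ Metric.diam B < δ :=
  mem_iInf_of_mem δ (mem_iInf_of_mem hδ (mem_principal_self _))

theorem IsBusemannFellerBasis.measure_pos (h𝓑 : IsBusemannFellerBasis μ 𝓑)
    (hμ : BallsPosFinite μ) {x : X} {B : Set X} (hB : B ∈ 𝓑 x) : μ B ≠ 0 := by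
  obtain ⟨r, hr, hrB⟩ := Metric.isOpen_iff.1 (h𝓑.isOpen x B hB) x (h𝓑.mem x B hB)
  exact ((hμ x r hr).1.trans_le (measure_mono hrB)).ne'

theorem IsBusemannFellerBasis.measure_lt_top (h𝓑 : IsBusemannFellerBasis μ 𝓑)
    (hμ : BallsPosFinite μ) {x : X} {B : Set X} (hB : B ∈ 𝓑 x) : μ B ≠ ∞ := by
  obtain ⟨r, hr, hrB⟩ := (h𝓑.isBounded x B hB).subset_ball_lt 0 x
  exact ((measure_mono hrB).trans_lt (hμ x r hr).2).ne

theorem laverage_add_add_le {X : Type*} [MeasurableSpace X] {μ : Measure X}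
    {𝓑 : X → Set (Set X)} {f : X → ℝ≥0∞} {v : X → EReal} (hf : AEMeasurable f μ) (c : NNReal)
    (e : ℝ≥0∞) {x : X} {B : Set X} (hB : B ∈ ⋃ y, 𝓑 y) (hx : x ∈ B) (hB₀ : μ B ≠ 0)
    (hBt : μ B ≠ ∞) :
    ⨍⁻ y in B, (f y + c * (v y).abs + e) ∂μ ≤
      maximalFunction μ 𝓑 (fun x => (f x : EReal)) x + c * maximalFunction μ 𝓑 v x + e := by
  have hadd : ⨍⁻ y in B, (f y + c * (v y).abs + e) ∂μ =
      ⨍⁻ y in B, f y ∂μ + ⨍⁻ y in B, c * (v y).abs ∂μ + ⨍⁻ _y in B, e ∂μ := by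
    simp only [laverage]
    rw [lintegral_add_right _ measurable_const,
      lintegral_add_left' (hf.restrict.smul_measure _)]
  rw [hadd, setLAverage_const hB₀ hBt, setLAverage_const_mul]
  gcongr
  · have := laverage_le_maximalFunction (μ := μ) (u := fun x => (f x : EReal)) hB hx
    simpa only [EReal.abs_coe_ennreal] using this
  · exact laverage_le_maximalFunction hB hx

/-- Off an open set `U` outside of which `u` is continuous, the averages of `u` are controlled by
the maximal functions of a truncation of `u` and of a function majorizing the indicator of `U`. -/
theorem eventually_edist_integralAverage_le (hμ : BallsPosFinite μ)
    (h𝓑 : IsBusemannFellerBasis μ 𝓑) {u v : X → EReal} (hu : MemLZero μ u) {U : Set X}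
    (hU : IsOpen U) (huU : ContinuousOn u Uᶜ) (hv : ∀ x ∈ U, 1 ≤ (v x).abs) (n : ℕ) {L : NNReal}
    (hL : 3 * (n : ℝ≥0∞) ≤ L) {x : X} (hx : x ∉ U) (hux : (u x).abs ≤ L) {a : ℝ≥0∞} (ha : a ≠ ∞)
    (hf : maximalFunction μ 𝓑 (fun x => (upperTruncation u n x : EReal)) x ≤ a)
    (hvx : ((2 * L : NNReal) : ℝ≥0∞) * maximalFunction μ 𝓑 v x ≤ a) {e : ℝ≥0∞} (he : 0 < e)
    (het : e ≠ ∞) :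
    ∀ᶠ B in basisFilter 𝓑 x, edist (integralAverage μ u B) (u x).toReal ≤ a + a + e := by
  have hLof : ENNReal.ofReal (L : ℝ) = L := ENNReal.ofReal_coe_nnreal
  obtain ⟨h, hc, hbd, heq⟩ := exists_continuous_eq_clampToReal hU huU L.coe_nonneg
  have hxh : (u x).toReal = h x := by
    rw [heq x hx, toReal_eq_clampToReal L.coe_nonneg (by rwa [hLof])]
  obtain ⟨δ, hδ, hδh⟩ := Metric.eventually_nhds_iff.1
    ((EMetric.tendsto_nhds.1 hc.continuousAt) e he)
  filter_upwards [eventually_basisFilter (𝓑 := 𝓑) x hδ] with B ⟨hB, hdiam⟩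
  have hB₀ := h𝓑.measure_pos hμ hB
  have hBt := h𝓑.measure_lt_top hμ hB
  have hxB := h𝓑.mem x B hB
  have hBm : NullMeasurableSet B μ := h𝓑.measurable x B hB
  have hbound := (laverage_add_add_le (𝓑 := 𝓑) (v := v)
    (hu.aemeasurable_abs.sub aemeasurable_const : AEMeasurable (upperTruncation u n) μ)
    (2 * L) e (Set.mem_iUnion.2 ⟨x, hB⟩) hxB hB₀ hBt).trans
    (add_le_add_left (add_le_add hf hvx) e)
  refine (edist_average_le hB₀ hBt hu.1.ereal_toReal _ ?_ ?_).trans hbound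
  · filter_upwards [ae_restrict_mem₀ hBm, ae_restrict_of_ae hu.ae_abs_ne_top] with y hyB hy
    -- The chain `u(y)`, clamped `u(y)`, `h(y)`, `h(x) = u(x)` costs the truncation, then at most
    -- `2L` and only on `U`, then the continuity error of `h`.
    have h₁ : edist (u y).toReal (clampToReal L (u y)) ≤ upperTruncation u n y := by
      refine (edist_clampToReal_le L.coe_nonneg hy).trans ?_
      rw [hLof]
      exact tsub_le_tsub_left hL _
    have h₂ : edist (clampToReal L (u y)) (h y) ≤ ((2 * L : NNReal) : ℝ≥0∞) * (v y).abs := by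
      by_cases hyU : y ∈ U
      · have h2L : edist (clampToReal L (u y)) (h y) ≤ ((2 * L : NNReal) : ℝ≥0∞) := by
          rw [edist_dist, ENNReal.ofReal_le_iff_le_toReal ENNReal.coe_ne_top, Real.dist_eq]
          refine (abs_sub _ _).trans ?_
          have := abs_clampToReal_le L.coe_nonneg (u y)
          have := hbd y
          simp only [ENNReal.coe_toReal, NNReal.coe_mul, NNReal.coe_ofNat]
          linarith
        calc _ ≤ ((2 * L : NNReal) : ℝ≥0∞) * 1 := by rwa [mul_one]
          _ ≤ _ := by gcongr; exact hv y hyU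
      · rw [heq y hyU, edist_self]
        exact zero_le
    have h₃ : edist (h y) (h x) ≤ e :=
      (hδh ((Metric.dist_le_diam_of_mem (h𝓑.isBounded x B hB) hyB hxB).trans_lt hdiam)).le
    rw [hxh]
    exact (edist_triangle4 _ _ _ _).trans (add_le_add (add_le_add h₁ h₂) h₃)
  · exact (hbound.trans_lt (by finiteness)).ne

/-- The complement is the part of the closed set `Uᶜ` that `u`, continuous there, maps into `[-L,
L]`. Openness matters because the capacity tests functions on neighbourhoods. -/
theorem isOpen_union_superlevel {X : Type*} [MetricSpace X] {u : X → EReal} {U : Set X} (hU : IsOpen U)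
    (huU : ContinuousOn u Uᶜ) (L : NNReal) : IsOpen (U ∪ {x | (L : ℝ≥0∞) < (u x).abs}) := by
  have hclosed := huU.preimage_isClosed_of_isClosed hU.isClosed_compl
    (isClosed_Icc (a := ((-L : ℝ) : EReal)) (b := ((L : ℝ) : EReal)))
  rw [← isClosed_compl_iff]
  convert hclosed using 1
  ext x
  have := abs_le_ofReal_iff L.coe_nonneg (z := u x)
  rw [ENNReal.ofReal_coe_nnreal] at this
  rw [Set.mem_inter_iff, Set.mem_preimage, ← this]
  simp

/-- At every scale `2⁻ᵐ`, averages are controlled off three sets of small capacity. -/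
theorem exists_small_capacity_sets (hμ : BallsPosFinite μ) (h𝓑 : IsBusemannFellerBasis μ 𝓑)
    (hp₁ : 1 ≤ p) (hp : p ≠ ∞) (hs : 0 < s) (hΦ : IsGradientNorm μ p Φ)
    (H : ∀ t : ℝ, 0 < t → ∀ u : ℕ → X → EReal,
      (∀ k, u k ∈ spaceOf μ (gradientSpaceNorm μ s p Φ)) →
      Tendsto (fun k => gradientSpaceNorm μ s p Φ (u k)) atTop (𝓝 0) →
      Tendsto (fun k => capacity μ (gradientSpaceNorm μ s p Φ) p
        {x | ENNReal.ofReal t < maximalFunction μ 𝓑 (u k) x}) atTop (𝓝 0))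
    {u : X → EReal} (hu : u ∈ spaceOf μ (gradientSpaceNorm μ s p Φ))
    (hq : IsQuasicontinuous μ (gradientSpaceNorm μ s p Φ) p u) (m : ℕ) :
    ∃ S : Fin 3 → Set X, (∀ i, capacity μ (gradientSpaceNorm μ s p Φ) p (S i) <
      ((2 : ℝ≥0∞)⁻¹ ^ m) ^ p.toReal) ∧
      ∀ x, (∀ i, x ∉ S i) → (u x).abs ≠ ∞ ∧ ∀ e : ℝ≥0∞, 0 < e → e ≠ ∞ →
        ∀ᶠ B in basisFilter 𝓑 x, edist (integralAverage μ u B) (u x).toReal ≤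
          (2 : ℝ≥0∞)⁻¹ ^ m + (2 : ℝ≥0∞)⁻¹ ^ m + e := by
  have hppos : 0 < p.toReal := ENNReal.toReal_pos (zero_lt_one.trans_le hp₁).ne' hp
  have hpow : ∀ k : ℕ, 0 < (2 : ℝ≥0∞)⁻¹ ^ k := fun k => ENNReal.pow_pos (by simp) k
  have hpp : 0 < ((2 : ℝ≥0∞)⁻¹ ^ m) ^ p.toReal := ENNReal.rpow_pos (hpow m) (by finiteness)
  have hofReal : ENNReal.ofReal ((2 : ℝ)⁻¹ ^ m) = (2 : ℝ≥0∞)⁻¹ ^ m := by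
    rw [ENNReal.ofReal_pow (by norm_num), ENNReal.ofReal_inv_of_pos (by norm_num)]
    simp
  obtain ⟨hfs, hflim⟩ := tendsto_norm_upperTruncation hp₁ hp hs hΦ hu
  obtain ⟨n, hnN, hncap⟩ := ((hflim.eventually_lt_const (hpow (m + 2))).and
    ((H ((2 : ℝ)⁻¹ ^ m) (by positivity) _ hfs hflim).eventually_lt_const hpp)).exists
  -- With this `L` the truncation `(|u| - 3n)₊` is at least `1` where `|u| > L`.
  set L : NNReal := 3 * n + 1 with hLdef
  have hex : ∀ k : ℕ, ∃ v ∈ spaceOf μ (gradientSpaceNorm μ s p Φ),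
      gradientSpaceNorm μ s p Φ v < (2 : ℝ≥0∞)⁻¹ ^ k ∧
      ∃ U, IsOpen U ∧ ContinuousOn u Uᶜ ∧ ∀ x ∈ U, 1 ≤ (v x).abs := by
    intro k
    obtain ⟨E, hE, hEu⟩ := hq (((2 : ℝ)⁻¹ ^ k) ^ p.toReal) (by positivity)
    rw [← ENNReal.ofReal_rpow_of_pos (by positivity), ENNReal.ofReal_pow (by norm_num),
      ENNReal.ofReal_inv_of_pos (by norm_num), ENNReal.ofReal_ofNat] at hE
    obtain ⟨v, hv, hvN, U, hU, hEU, h1⟩ := exists_of_capacity_lt hp₁ hp hE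
    exact ⟨v, hv, hvN, U, hU, hEu.mono (Set.compl_subset_compl.2 hEU), h1⟩
  choose v hv hvN U hU hUu h1 using hex
  have hvlim : Tendsto (fun k => gradientSpaceNorm μ s p Φ (v k)) atTop (𝓝 0) :=
    tendsto_of_tendsto_of_tendsto_of_le_of_le tendsto_const_nhds
      (ENNReal.tendsto_pow_atTop_nhds_zero_of_lt_one (ENNReal.inv_lt_one.2 ENNReal.one_lt_two))
      (fun k => zero_le) (fun k => (hvN k).le)
  have hLpos : (0 : ℝ) < 2 * L := by
    rw [hLdef]; push_cast; positivity
  -- The index `k` is chosen after `n`, because the level `2⁻ᵐ / (2L)` depends on `n`; (2) is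
  -- available at every positive level.
  obtain ⟨k, hkcap, hkN⟩ := (((H ((2 : ℝ)⁻¹ ^ m / (2 * L)) (by positivity) v hv
    hvlim).eventually_lt_const hpp).and (hvlim.eventually_lt_const (hpow (m + 2)))).exists
  obtain ⟨F, hF, hFN, hFle⟩ := exists_majorant_of_pair (s := s) hp₁ hΦ (hfs n).1 (hv k).1
    (by finiteness) (by finiteness) hnN hkN
  refine ⟨![U k ∪ {x | (L : ℝ≥0∞) < (u x).abs},
    {x | ENNReal.ofReal ((2 : ℝ)⁻¹ ^ m) <
      maximalFunction μ 𝓑 (fun x => (upperTruncation u n x : EReal)) x},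
    {x | ENNReal.ofReal ((2 : ℝ)⁻¹ ^ m / (2 * L)) < maximalFunction μ 𝓑 (v k) x}], ?_, ?_⟩
  · intro i
    fin_cases i
    · refine (capacity_le_of_isOpen (isOpen_union_superlevel (hU k) (hUu k) L) hF ?_
        hFN).trans_lt ?_
      · rintro x (hx | hx)
        · exact (h1 k x hx).trans (hFle x).2
        · refine le_trans ?_ (hFle x).1
          rw [EReal.abs_coe_ennreal, upperTruncation]
          refine ENNReal.le_sub_of_add_le_left (by finiteness) (le_trans (le_of_eq ?_) hx.le)
          rw [hLdef]
          push_cast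
          rfl
      · refine ENNReal.rpow_lt_rpow ?_ hppos
        -- Two norms below `2^(-m-2)` leave room for the strict bound `2⁻ᵐ`.
        have h2 : (2 : ℝ≥0∞)⁻¹ ^ (m + 2) + (2 : ℝ≥0∞)⁻¹ ^ (m + 2) = (2 : ℝ≥0∞)⁻¹ ^ (m + 1) := by
          rw [pow_succ _ (m + 1), ← mul_add, ENNReal.inv_two_add_inv_two, mul_one]
        rw [h2]
        rw [pow_succ, ← div_eq_mul_inv]
        exact ENNReal.half_lt_self (hpow m).ne' (by finiteness)
    · exact hncap
    · exact hkcap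
  · intro x hx
    have hx0 : x ∉ U k ∧ (u x).abs ≤ L := by simpa using hx 0
    have hx1 : maximalFunction μ 𝓑 (fun x => (upperTruncation u n x : EReal)) x ≤
        (2 : ℝ≥0∞)⁻¹ ^ m := by
      rw [← hofReal]
      exact not_lt.1 (hx 1)
    have hx2 : ((2 * L : NNReal) : ℝ≥0∞) * maximalFunction μ 𝓑 (v k) x ≤ (2 : ℝ≥0∞)⁻¹ ^ m := by
      have h3 : maximalFunction μ 𝓑 (v k) x ≤ ENNReal.ofReal ((2 : ℝ)⁻¹ ^ m / (2 * L)) :=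
        not_lt.1 (hx 2)
      have h4 : ((2 * L : NNReal) : ℝ≥0∞) = ENNReal.ofReal (2 * L) := by
        rw [← ENNReal.ofReal_coe_nnreal]
        push_cast
        rfl
      calc _ ≤ ((2 * L : NNReal) : ℝ≥0∞) * ENNReal.ofReal ((2 : ℝ)⁻¹ ^ m / (2 * L)) := by gcongr
        _ = (2 : ℝ≥0∞)⁻¹ ^ m := by
          rw [h4, ← ENNReal.ofReal_mul hLpos.le, mul_div_cancel₀ _ hLpos.ne', hofReal]
    refine ⟨(hx0.2.trans_lt ENNReal.coe_lt_top).ne, fun e he het => ?_⟩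
    refine eventually_edist_integralAverage_le hμ h𝓑 hu.1 (hU k) (hUu k) (h1 k) n ?_ hx0.1 hx0.2
      (by finiteness) hx1 hx2 he het
    rw [hLdef]
    push_cast
    exact le_self_add

/-- If the maximal operator is continuous at zero in capacity, then quasicontinuous functions have
Lebesgue points outside a set of capacity zero. -/
theorem exists_capacity_zero_tendsto_integralAverage (hμ : BallsPosFinite μ)
    (h𝓑 : IsBusemannFellerBasis μ 𝓑)
    (hp₁ : 1 ≤ p) (hp : p ≠ ∞) (hs : 0 < s) (hΦ : IsGradientNorm μ p Φ)
    (H : ∀ t : ℝ, 0 < t → ∀ u : ℕ → X → EReal,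
      (∀ k, u k ∈ spaceOf μ (gradientSpaceNorm μ s p Φ)) →
      Tendsto (fun k => gradientSpaceNorm μ s p Φ (u k)) atTop (𝓝 0) →
      Tendsto (fun k => capacity μ (gradientSpaceNorm μ s p Φ) p
        {x | ENNReal.ofReal t < maximalFunction μ 𝓑 (u k) x}) atTop (𝓝 0))
    {u : X → EReal} (hu : u ∈ spaceOf μ (gradientSpaceNorm μ s p Φ))
    (hq : IsQuasicontinuous μ (gradientSpaceNorm μ s p Φ) p u) :
    ∃ E : Set X, capacity μ (gradientSpaceNorm μ s p Φ) p E = 0 ∧ ∀ x ∉ E,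
      Tendsto (fun B => ((integralAverage μ u B : ℝ) : EReal)) (basisFilter 𝓑 x)
        (𝓝 (u x)) := by
  choose S hScap hS using fun m => exists_small_capacity_sets hμ h𝓑 hp₁ hp hs hΦ H hu hq m
  have hzero := fun i => capacity_limsup_eq_zero hp₁ hp hΦ fun m => hScap m i
  refine ⟨_, capacity_union_eq_zero hp₁ hp hΦ (hzero 0)
    (capacity_union_eq_zero hp₁ hp hΦ (hzero 1) (hzero 2)), fun x hx => ?_⟩
  simp only [Set.mem_union, not_or, Set.mem_iInter, Set.mem_iUnion, not_forall, not_exists] at hx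
  obtain ⟨⟨n₀, h₀⟩, ⟨n₁, h₁⟩, ⟨n₂, h₂⟩⟩ := hx
  have hgood : ∀ m, n₀ + n₁ + n₂ ≤ m → ∀ i, x ∉ S m i := by
    intro m hm i
    fin_cases i
    · simpa [Nat.add_sub_cancel' (by omega : n₀ ≤ m)] using h₀ (m - n₀)
    · simpa [Nat.add_sub_cancel' (by omega : n₁ ≤ m)] using h₁ (m - n₁)
    · simpa [Nat.add_sub_cancel' (by omega : n₂ ≤ m)] using h₂ (m - n₂)
  have hfin := (hS _ x (hgood _ le_rfl)).1
  rw [EReal.abs_ne_top_iff] at hfin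
  -- At a good point `u(x)` is finite, so convergence in `EReal` reduces to real convergence.
  rw [← EReal.coe_toReal hfin.1 hfin.2]
  refine (continuous_coe_real_ereal.tendsto _).comp ?_
  rw [EMetric.tendsto_nhds]
  intro ε hε
  have hlim : Tendsto (fun m : ℕ => (2 : ℝ≥0∞)⁻¹ ^ m + (2 : ℝ≥0∞)⁻¹ ^ m + (2 : ℝ≥0∞)⁻¹ ^ m)
      atTop (𝓝 0) := by
    have h := ENNReal.tendsto_pow_atTop_nhds_zero_of_lt_one
      (ENNReal.inv_lt_one.2 ENNReal.one_lt_two)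
    simpa using (h.add h).add h
  obtain ⟨m, hmε, hm⟩ := ((hlim.eventually_lt_const hε).and
    (eventually_ge_atTop (n₀ + n₁ + n₂))).exists
  filter_upwards [(hS m x (hgood m hm)).2 ((2 : ℝ≥0∞)⁻¹ ^ m) (ENNReal.pow_pos (by simp) m)
    (by finiteness)] with B hB
  exact hB.trans_lt hmε

end Lebesgue

end

theorem theoremM {X : Type*} [MetricSpace X] [TopologicalSpace.SeparableSpace X]
    [MeasurableSpace X] [BorelSpace X] (μ : Measure X) (hμ : BallsPosFinite μ)
    (𝓑 : X → Set (Set X)) (h𝓑 : IsBusemannFellerBasis μ 𝓑)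
    (p : ℝ≥0∞) (hp₁ : 1 < p) (hp : p < ∞)
    (N : (X → EReal) → ℝ≥0∞)
    (hN :
      (∃ (s : ℝ) (q : ℝ≥0∞), 0 < s ∧ s < 1 ∧ 1 < q ∧ q < ∞ ∧
        (N = besovNorm μ s p q ∨ N = triebelLizorkinNorm μ s p q)) ∨
      (∃ s : ℝ, 0 < s ∧ s ≤ 1 ∧
        (N = triebelLizorkinNorm μ s p ∞ ∨ N = hajlaszNorm μ s p))) :
    ((∀ u ∈ spaceOf μ N,
        Tendsto (fun t : ℝ => capacity μ N p {x | ENNReal.ofReal t < maximalFunction μ 𝓑 u x})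
          atTop (𝓝 0)) →
      ∀ t : ℝ, 0 < t → ∀ u : ℕ → X → EReal, (∀ k, u k ∈ spaceOf μ N) →
        Tendsto (fun k => N (u k)) atTop (𝓝 0) →
        Tendsto
          (fun k => capacity μ N p {x | ENNReal.ofReal t < maximalFunction μ 𝓑 (u k) x})
          atTop (𝓝 0)) ∧
    ((∀ t : ℝ, 0 < t → ∀ u : ℕ → X → EReal, (∀ k, u k ∈ spaceOf μ N) →
        Tendsto (fun k => N (u k)) atTop (𝓝 0) →
        Tendsto
          (fun k => capacity μ N p {x | ENNReal.ofReal t < maximalFunction μ 𝓑 (u k) x})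
          atTop (𝓝 0)) →
      ∀ u ∈ spaceOf μ N, IsQuasicontinuous μ N p u →
        ∃ E : Set X, capacity μ N p E = 0 ∧ ∀ x ∉ E,
          Tendsto (fun B => ((integralAverage μ u B : ℝ) : EReal)) (basisFilter 𝓑 x)
            (𝓝 (u x))) := by
  -- All four norms are instances of `gradientSpaceNorm`: three by definition, the Hajłasz norm
  -- through its equality with the case `q = ∞`.
  obtain ⟨s, Φ, hs, hΦ, rfl⟩ : ∃ (s : ℝ) (Φ : (ℤ → X → ℝ≥0∞) → ℝ≥0∞), 0 < s ∧
      IsGradientNorm μ p Φ ∧ N = gradientSpaceNorm μ s p Φ := by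
    rcases hN with ⟨s, q, hs, -, hq₁, hq, rfl | rfl⟩ | ⟨s, hs, -, rfl | rfl⟩
    · exact ⟨s, _, hs, isGradientNorm_besov μ hp₁.le hp.ne hq₁.le hq.ne, rfl⟩
    · exact ⟨s, _, hs, isGradientNorm_triebelLizorkin μ hp₁.le hp.ne hq₁.le, rfl⟩
    · exact ⟨s, _, hs, isGradientNorm_triebelLizorkin μ hp₁.le hp.ne le_top, rfl⟩
    · exact ⟨s, _, hs, isGradientNorm_triebelLizorkin μ hp₁.le hp.ne le_top, hajlaszNorm_eq μ s p⟩
  exact ⟨fun H t ht u hu hlim => tendsto_capacity_maximalFunction hp₁.le hΦ H ht hu hlim,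
    fun H u hu hq => exists_capacity_zero_tendsto_integralAverage hμ h𝓑 hp₁.le hp.ne hs hΦ H hu hq⟩
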